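/- \textbf{Setting (symbolic qCCS).} Let $cVar$, $qVar$ be countably infinite sets of classical and quantum variables, $cChan$, $qChan$ sets of classical and quantum channel names, $Chan=cChan\sqcup qChan$. $Exp$ is the set of real-valued expressions built from classical variables, real constants and given function symbols interpreted over $\mathbb R$; $BExp$ is the set of boolean expressions built from comparisons $e\bowtie e'$ ($\bowtie\in\{>,<,\ge,\le,=\}$), given predicates on expressions, true, false, $\neg,\wedge,\vee,\to$. For $b,c\in BExp$ and $B\subseteq BExp$, "$b\to c$" (resp. "$b\to\bigvee B$") means that every evaluation $\psi:cVar\to\mathbb R$ making $b$ true makes $c$ (resp. some element of $B$) true. Process terms are, up to $\alpha$-conversion, $$t::=\mathbf{nil}\mid A(\tilde e,\tilde q)\mid \tau.t\mid c?x.t\mid c!e.t\mid \mathsf c?q.t\mid \mathsf c!q.t\mid \mathcal E[\tilde q].t\mid M[\tilde q;x].t\mid t+t\mid t\|t\mid t\backslash L\mid t[f]\mid \mathbf{if}\ b\ \mathbf{then}\ t,$$ where $\tilde q$ is a tuple of $n$ distinct quantum variables, $\mathcal E$ a trace-preserving completely positive super-operator on $(\mathbb C^2)^{\otimes n}$, $M$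 a projective measurement (self-adjoint operator) on $(\mathbb C^2)^{\otimes n}$ with only non-degenerate eigenvalues, $L\subseteq Chan$, and $f$ an injective relabelling preserving the two kinds of channels; $c?x$ and $M[\tilde q;x]$ bind $x$, and $\mathsf c?q$ binds $q$. With $fv(t)$, $qv(t)$ the free classical and quantum variables, it is required that $q\notin qv(t)$ in $\mathsf c!q.t$ and $qv(t)\cap qv(u)=\emptyset$ in $t\|u$. Every process constant has a defining equation $A(\tilde x,\tilde q)=t_A$ with $fv(t_A)\subseteq\tilde x$, $qv(t_A)\subseteq\tilde q$. For $V\subseteq qVar$ let $\mathcal H_V=\bigotimes_{q\in V}\mathbb C^2$ (the separable space with orthonormal basis the finitely supported maps $V\to\{0,1\}$), $\mathcal H=\mathcal H_{qVar}$, let $CP(\mathcal H_V)$ be the semiring (under $+$ and composition) of completely positive super-operators on the trace class operators of $\mathcal H_V$, and $CP_t(\mathcal H_V)$ the trace-preserving ones, which also act on $\mathcal H$ by tensoring with the identity. Write $\mathcal A\eqsim_V\mathcal B$ if $\mathrm{tr}_{\overline V}\mathcal A(\rho)=\mathrm{tr}_{\overline V}\mathcal B(\rho)$ for all density operators $\rho$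 on $\mathcal H$, and $\eqsim$ for $\eqsim_\emptyset$. A super-operator valued distribution on $X$ is a finitely supported $\Delta:X\to CP(\mathcal H)$ with $\sum_x\Delta(x)\eqsim\mathcal I$; $\mathcal A\bullet x$ has value $\mathcal A$ at $x$ and $0$ elsewhere; $(\mathcal A\bullet\Delta)(x)=\Delta(x)\circ\mathcal A$. Snapshots are pairs $(t,\mathcal E)$ of a process term and $\mathcal E\in CP_t(\mathcal H)$. Symbolic actions $\gamma$ are $\tau,c?x,c!e,\mathsf c?r,\mathsf c!r$; $bv(c?x)=\{x\}$, $qbv(\mathsf c?r)=\{r\}$, and $bv$, $qbv$ are empty otherwise; $cn(\gamma)$ is the set of channels of $\gamma$. Transitions $s\xrightarrow{b,\gamma}\Delta$ are generated by the following rules (writing $s'$ for $\mathcal I\bullet s'$): \begin{itemize} \item $(\gamma.t,\mathcal E)\xrightarrow{\mathrm{true},\gamma}(t,\mathcal E)$, where by $\alpha$-conversion the bound variable of an input may be any variable not free in the input process; \item $(\mathcal F[\tilde r].t,\mathcal E)\xrightarrow{\mathrm{true},\tau}(t,\mathcal F_{\tilde r}\mathcal E)$; \item if $M=\sum_i\lambda_i|\phi_i\rangle\langle\phi_i|$,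 then $(M[\tilde r;x].t,\mathcal E)\xrightarrow{\mathrm{true},\tau}\sum_i\mathcal A_i\bullet(t\{\lambda_i/x\},\mathcal S_i\mathcal E)$, where $\mathcal A_i(\rho)=|\phi_i\rangle\langle\phi_i|\rho|\phi_i\rangle\langle\phi_i|$ and $\mathcal S_i(\rho)=\sum_j|\phi_i\rangle\langle\phi_j|\rho|\phi_j\rangle\langle\phi_i|$ act on $\tilde r$; \item $t+u$ has the transitions of $t$ and those of $u$; $A(\tilde e,\tilde r)$ has those of $t_A\{\tilde e/\tilde x,\tilde r/\tilde q\}$; \item if $(t,\mathcal E)\xrightarrow{b,\gamma}\Delta$, then $(t\|u,\mathcal E)\xrightarrow{b,\gamma}\Delta\|u$ when $bv(\gamma)\cap fv(u)=\emptyset=qbv(\gamma)\cap qv(u)$; $(t\backslash L,\mathcal E)\xrightarrow{b,\gamma}\Delta\backslash L$ when $cn(\gamma)\cap L=\emptyset$; $(t[f],\mathcal E)\xrightarrow{b,f(\gamma)}\Delta[f]$; $(\mathbf{if}\ b'\ \mathbf{then}\ t,\mathcal E)\xrightarrow{b'\wedge b,\gamma}\Delta$; \item if $(t,\mathcal E)\xrightarrow{b_1,c?x}(t',\mathcal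 E)$ and $(u,\mathcal E)\xrightarrow{b_2,c!e}(u',\mathcal E)$, then $(t\|u,\mathcal E)\xrightarrow{b_1\wedge b_2,\tau}(t'\{e/x\}\|u',\mathcal E)$; if $(t,\mathcal E)\xrightarrow{b_1,\mathsf c?r}(t',\mathcal E)$ and $(u,\mathcal E)\xrightarrow{b_2,\mathsf c!r}(u',\mathcal E)$, then $(t\|u,\mathcal E)\xrightarrow{b_1\wedge b_2,\tau}(t'\|u',\mathcal E)$; \item the symmetric forms of the rules for $\|$. \end{itemize} For an equivalence relation $\mathcal S$ on snapshots put $\Delta\,\mathcal S\,\Xi$ if $\sum_{s\in T}\Delta(s)\eqsim\sum_{s\in T}\Xi(s)$ for every equivalence class $T$ of $\mathcal S$. Write $\gamma=_b\gamma'$ if $\gamma=c!e$, $\gamma'=c!e'$ and $b\to e=e'$, or if $\gamma=\gamma'$ is not a classical output. A family $\{\mathcal S^b:b\in BExp\}$ of equivalence relations on snapshots is a \emph{symbolic bisimulation} if $(t,\mathcal E)\,\mathcal S^b\,(u,\mathcal F)$ implies: \begin{enumerate} \item if $b$ is satisfiable, then $qv(t)=qv(u)$ and $\mathcal E\eqsim_{\overline{qv(t)}}\mathcal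 F$; \item for every $\mathcal G\in CP_t(\mathcal H_{\overline{qv(t)}})$, whenever $(t,\mathcal{GE})\xrightarrow{b_1,\gamma}\Delta$ with $bv(\gamma)\cap(fv(b)\cup fv(t)\cup fv(u))=\emptyset$, there is a collection $B\subseteq BExp$ with $b\wedge b_1\to\bigvee B$ such that for each $b'\in B$ there are $b_2,\gamma',\Xi$ with $b'\to b_2$, $\gamma=_{b'}\gamma'$, $(u,\mathcal{GF})\xrightarrow{b_2,\gamma'}\Xi$ and $(\mathcal{GE}\bullet\Delta)\,\mathcal S^{b'}\,(\mathcal{GF}\bullet\Xi)$. \end{enumerate} Let $s\sim^b s'$ mean that $s\,\mathcal S^b\,s'$ for some symbolic bisimulation $\{\mathcal S^b\}$. \textbf{Theorem.} \begin{enumerate} \item For each $b\in BExp$, $\sim^b$ is an equivalence relation on snapshots. \item The family $\{\sim^b:b\in BExp\}$ is a symbolic bisimulation, and it is the largest one: $\mathcal S^b\subseteq{\sim^b}$ for every symbolic bisimulation $\{\mathcal S^b\}$ and every $b$. \end{enumerate} -/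

import Mathlib

open scoped ComplexOrder InnerProductSpace FirstOrder
open ContinuousLinearMap (adjoint)

noncomputable section

namespace QCCS

/-! ## Systems of qubits -/

/-- The state space `⨂_{q ∈ Q} ℂ²` of the qubits in `Q`: the Hilbert space with an orthonormal
basis indexed by the assignments of bits to the elements of `Q` that are `0` almost everywhere.
It has dimension `2 ^ n` when `Q` has `n` elements, and is separable and infinite-dimensional
when `Q` is countably infinite. -/
abbrev Hilb (Q : Type) : Type := lp (fun _ : Q →₀ Fin 2 => ℂ) 2

/-- The computational basis. -/
def stdBasis (Q : Type) : HilbertBasis (Q →₀ Fin 2) ℂ (Hilb Q) :=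
  HilbertBasis.ofRepr (LinearIsometryEquiv.refl ℂ (Hilb Q))

/-- The bit assignments of the qubits of `Q` outside the range of `e`. -/
abbrev Rest {Q' Q : Type} (e : Q' ↪ Q) : Type := {k : Q →₀ Fin 2 // ∀ q', k (e q') = 0}

/-- The bit assignment on `Q` which is `f` along `e` and `k` elsewhere. -/
def glue {Q' Q : Type} (e : Q' ↪ Q) (k : Rest e) (f : Q' →₀ Fin 2) : Q →₀ Fin 2 :=
  f.embDomain e + k.1

theorem glue_injective {Q' Q : Type} (e : Q' ↪ Q) (k : Rest e) :
    Function.Injective (glue e k) := fun _ _ h =>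
  Finsupp.embDomain_injective e (add_right_cancel h)

theorem orthonormal_glue {Q' Q : Type} (e : Q' ↪ Q) (k : Rest e) :
    Orthonormal ℂ (fun f => stdBasis Q (glue e k f)) :=
  (stdBasis Q).orthonormal.comp _ (glue_injective e k)

/-- The isometry `v ↦ v ⊗ |k⟩`, where the tensor factor `v` sits on the qubits `e q'`. -/
def ketR {Q' Q : Type} (e : Q' ↪ Q) (k : Rest e) : Hilb Q' →L[ℂ] Hilb Q :=
  (orthonormal_glue e k).orthogonalFamily.linearIsometry.toContinuousLinearMap

/-! ## Trace class operators and super-operators -/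

/-- Nuclear operators between Hilbert spaces, that is, trace class operators. -/
def IsNuclear {E F : Type} [NormedAddCommGroup E] [InnerProductSpace ℂ E]
    [NormedAddCommGroup F] [InnerProductSpace ℂ F] (A : E →L[ℂ] F) : Prop :=
  ∃ (u : ℕ → F) (v : ℕ → E), Summable (fun n => ‖u n‖ * ‖v n‖) ∧
    ∀ x, HasSum (fun n => ⟪v n, x⟫_ℂ • u n) (A x)

theorem IsNuclear.comp {E F E' F' : Type}
    [NormedAddCommGroup E] [InnerProductSpace ℂ E] [CompleteSpace E]
    [NormedAddCommGroup F] [InnerProductSpace ℂ F]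
    [NormedAddCommGroup E'] [InnerProductSpace ℂ E'] [CompleteSpace E']
    [NormedAddCommGroup F'] [InnerProductSpace ℂ F']
    {A : E →L[ℂ] F} (hA : IsNuclear A) (L : F →L[ℂ] F') (R : E' →L[ℂ] E) :
    IsNuclear (L ∘L A ∘L R) := by
  obtain ⟨u, v, hs, h⟩ := hA
  refine ⟨fun n => L (u n), fun n => adjoint R (v n), ?_, fun x => ?_⟩
  · refine Summable.of_nonneg_of_le (fun n => by positivity) (fun n => ?_)
      (hs.mul_left (‖L‖ * ‖adjoint R‖))
    calc ‖L (u n)‖ * ‖adjoint R (v n)‖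
        ≤ (‖L‖ * ‖u n‖) * (‖adjoint R‖ * ‖v n‖) := by
          gcongr <;> exact ContinuousLinearMap.le_opNorm _ _
      _ = ‖L‖ * ‖adjoint R‖ * (‖u n‖ * ‖v n‖) := by ring
  · have := (h (R x)).mapL L
    simpa [ContinuousLinearMap.adjoint_inner_left] using this

theorem IsNuclear.sum {E F : Type} [NormedAddCommGroup E] [InnerProductSpace ℂ E]
    [NormedAddCommGroup F] [InnerProductSpace ℂ F] {A B : E →L[ℂ] F}
    (hA : IsNuclear A) (hB : IsNuclear B) : IsNuclear (A + B) := by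
  obtain ⟨u, v, hs, h⟩ := hA
  obtain ⟨u', v', hs', h'⟩ := hB
  let e := Equiv.natSumNatEquivNat
  refine ⟨Sum.elim u u' ∘ e.symm, Sum.elim v v' ∘ e.symm, ?_, fun x => ?_⟩
  · exact (e.symm.summable_iff (f := fun i => ‖Sum.elim u u' i‖ * ‖Sum.elim v v' i‖)).2
      (Summable.sum _ (by exact hs) (by exact hs'))
  · exact (e.symm.hasSum_iff (f := fun i => ⟪Sum.elim v v' i, x⟫_ℂ • Sum.elim u u' i)).2
      (HasSum.sum (by exact h x) (by exact h' x))

/-- The space of trace class operators on the qubits in `Q`. -/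
def TC (Q : Type) : Submodule ℂ (Hilb Q →L[ℂ] Hilb Q) where
  carrier := {A | IsNuclear A}
  zero_mem' := ⟨0, 0, by simp, fun x => by simp⟩
  add_mem' := IsNuclear.sum
  smul_mem' c A hA := by
    have := hA.comp (c • ContinuousLinearMap.id ℂ (Hilb Q)) (ContinuousLinearMap.id ℂ (Hilb Q))
    have e : (c • ContinuousLinearMap.id ℂ (Hilb Q)) ∘L A ∘L ContinuousLinearMap.id ℂ (Hilb Q)
      = c • A := by ext1 x; simp
    rwa [e] at this

/-- The trace. -/
def trace {Q : Type} (A : TC Q) : ℂ :=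
  ∑' f, ⟪stdBasis Q f, A.1 (stdBasis Q f)⟫_ℂ

/-- Density operators. -/
def IsDensity {Q : Type} (ρ : TC Q) : Prop := ρ.1.IsPositive ∧ trace ρ = 1

/-- The map `ρ ↦ K ρ K†`. -/
def conj {Q : Type} (K : Hilb Q →L[ℂ] Hilb Q) : Module.End ℂ (TC Q) where
  toFun A := ⟨K ∘L A.1 ∘L adjoint K, IsNuclear.comp A.2 _ _⟩
  map_add' A B := by ext1; simp
  map_smul' c A := by ext1; simp

/-- Positivity of an `n × n` matrix of operators, as an operator on `Hilb Q ⊗ ℂⁿ`. -/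
def MatPos {Q : Type} {n : ℕ} (A : Fin n → Fin n → TC Q) : Prop :=
  ∀ v : Fin n → Hilb Q, 0 ≤ ∑ i, ∑ j, ⟪v i, (A i j).1 (v j)⟫_ℂ

/-- Completely positive super-operators, as a semiring under `+` and composition:
the linear maps on trace class operators which remain positive after tensoring with the identity
of an arbitrary auxiliary system. -/
def CP (Q : Type) : Subsemiring (Module.End ℂ (TC Q)) where
  carrier := {E | ∀ (n : ℕ) (A : Fin n → Fin n → TC Q), MatPos A → MatPos fun i j => E (A i j)}
  zero_mem' n A _ v := by simp
  one_mem' n A hA := by simpa using hA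
  add_mem' {E F} hE hF n A hA v := by
    have := add_nonneg (hE n A hA v) (hF n A hA v)
    simpa [inner_add_right, Finset.sum_add_distrib] using this
  mul_mem' {E F} hE hF n A hA := hE n _ (hF n A hA)

/-- Trace-preserving completely positive super-operators. -/
def CPt (Q : Type) : Submonoid (CP Q) where
  carrier := {E | ∀ A : TC Q, trace (E.1 A) = trace A}
  one_mem' _ := rfl
  mul_mem' {_ F} hE hF A := (hE (F.1 A)).trans (hF A)

/-- The block `⟨k| ρ |k'⟩` of an operator `ρ` on the qubits `Q`, where `k` and `k'` are basis
states of the qubits outside the range of `e`. -/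
def block {Q' Q : Type} (e : Q' ↪ Q) (k k' : Rest e) (ρ : TC Q) : TC Q' :=
  ⟨adjoint (ketR e k) ∘L ρ.1 ∘L ketR e k', IsNuclear.comp ρ.2 _ _⟩

/-- `G` is `G'`, performed on the qubits `e q'`, tensored with the identity super-operator of the
other qubits. -/
def Extends {Q' Q : Type} (e : Q' ↪ Q) (G' : Module.End ℂ (TC Q')) (G : Module.End ℂ (TC Q)) :
    Prop :=
  ∀ (ρ : TC Q) (k k' : Rest e), block e k k' (G ρ) = G' (block e k k' ρ)

/-- `G ∈ CP_t(H_V)`, regarded as a super-operator on the whole system. -/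
def ActsOn {Q : Type} (V : Set Q) (G : CPt Q) : Prop :=
  ∃ G' : CPt V, Extends (Function.Embedding.subtype (· ∈ V)) G'.1.1 G.1.1

/-- The partial trace `∑ₖ ⟨k| ρ |k⟩` over the qubits outside `V`. -/
def ptrace {Q : Type} (V : Set Q) (ρ : TC Q) : Hilb V →L[ℂ] Hilb V :=
  ∑' k : Rest (Function.Embedding.subtype (· ∈ V)), (block _ k k ρ).1

/-- `A ≲_V B`: after `A` the reduced state on `V` is below the one after `B` in the Löwner order. -/
def LeOn {Q : Type} (V : Set Q) (A B : CP Q) : Prop :=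
  ∀ ρ : TC Q, IsDensity ρ → (ptrace V (B.1 ρ) - ptrace V (A.1 ρ)).IsPositive

/-- `A ≂_V B`. -/
def EqOn {Q : Type} (V : Set Q) (A B : CP Q) : Prop := LeOn V A B ∧ LeOn V B A

/-- A projective measurement of `n` qubits all of whose eigenvalues are non-degenerate. -/
structure Measurement (n : ℕ) where
  op : Hilb (Fin n) →L[ℂ] Hilb (Fin n)
  selfAdjoint : IsSelfAdjoint op
  nondegenerate : ∀ μ : ℂ, Module.finrank ℂ (Module.End.eigenspace op.toLinearMap μ) ≤ 1

/-! ## Super-operator valued distributions -/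

/-- Finitely supported functions to super-operators. -/
abbrev SVal (Q : Type) (X : Type 1) := X →₀ CP Q

/-- The super-operator valued distributions among them. -/
def IsDist {Q : Type} {X : Type 1} (Δ : SVal Q X) : Prop := EqOn ∅ (Δ.sum fun _ A => A) 1

/-- The total weight `Δ(T)` of a set of states. -/
def mass {Q : Type} {X : Type 1} (Δ : SVal Q X) (T : Set X) : CP Q :=
  open Classical in (Δ.filter (· ∈ T)).sum fun _ A => A

/-- The combination `E • Δ`, which is `s ↦ Δ(s) ∘ E`. -/
def combine {Q : Type} {X : Type 1} (E : CP Q) (Δ : SVal Q X) : SVal Q X :=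
  Δ.mapRange (fun A => A * E) (zero_mul E)

/-- The lifting of a relation `R` on states, meant for equivalence relations: equal weight, up to
`≂_∅`, on every class of `R`. -/
def Lift {Q : Type} {X : Type 1} (R : X → X → Prop) (Δ Ξ : SVal Q X) : Prop :=
  ∀ s, EqOn ∅ (mass Δ {s' | R s s'}) (mass Ξ {s' | R s s'})

/-! ## Syntax -/

/-- The names of a qCCS calculus. The data expressions are built from classical variables, real
constants and the function symbols of `lang`; the boolean expressions may use, besides the
comparisons, the relation symbols of `lang`. -/
structure Signature where
  cVar : Type
  qVar : Type
  [cVar_infinite : Infinite cVar]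
  [cVar_countable : Countable cVar]
  [qVar_infinite : Infinite qVar]
  [qVar_countable : Countable qVar]
  cChan : Type
  qChan : Type
  /-- process constant schemes, with their arities -/
  Con : Type
  arC : Con → ℕ
  arQ : Con → ℕ
  lang : FirstOrder.Language.{0, 0}
  [str : lang.Structure ℝ]

attribute [instance] Signature.cVar_infinite Signature.cVar_countable Signature.qVar_infinite
  Signature.qVar_countable Signature.str

variable (S : Signature)

/-- Classical data expressions over the variables `X`. -/
abbrev Exp (X : Type) : Type := S.lang[[ℝ]].Term X

variable {S}

/-- The constant expression `r`. -/
def Exp.const {X : Type} (r : ℝ) : Exp S X := (S.lang.con r).term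

/-- The value of an expression under an evaluation. -/
def Exp.eval {X : Type} (e : Exp S X) (ψ : X → ℝ) : ℝ := e.realize ψ

/-- The variables of an expression. -/
def Exp.fv {X : Type} (e : Exp S X) : Set X :=
  open Classical in {x | x ∈ e.varFinset}

inductive Cmp
  | gt | lt | ge | le | eq

def Cmp.eval : Cmp → ℝ → ℝ → Prop
  | gt, r, s => r > s
  | lt, r, s => r < s
  | ge, r, s => r ≥ s
  | le, r, s => r ≤ s
  | eq, r, s => r = s

variable (S)

/-- Boolean expressions over the classical variables `X`. -/
inductive BExp (X : Type) : Type
  | tt : BExp X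
  | ff : BExp X
  | not : BExp X → BExp X
  | and : BExp X → BExp X → BExp X
  | or : BExp X → BExp X → BExp X
  | imp : BExp X → BExp X → BExp X
  | cmp : Cmp → Exp S X → Exp S X → BExp X
  | rel {n : ℕ} : S.lang.Relations n → (Fin n → Exp S X) → BExp X

variable {S}

namespace BExp

/-- Truth under an evaluation. -/
def eval {X : Type} (ψ : X → ℝ) : BExp S X → Prop
  | tt => True
  | ff => False
  | not b => ¬ b.eval ψ
  | and b c => b.eval ψ ∧ c.eval ψ
  | or b c => b.eval ψ ∨ c.eval ψ
  | imp b c => b.eval ψ → c.eval ψ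
  | cmp o e e' => o.eval (Exp.eval e ψ) (Exp.eval e' ψ)
  | rel r es => FirstOrder.Language.Structure.RelMap r fun i => Exp.eval (es i) ψ

def fv {X : Type} : BExp S X → Set X
  | tt => ∅
  | ff => ∅
  | not b => b.fv
  | and b c => b.fv ∪ c.fv
  | or b c => b.fv ∪ c.fv
  | imp b c => b.fv ∪ c.fv
  | cmp _ e e' => Exp.fv e ∪ Exp.fv e'
  | rel _ es => ⋃ i, Exp.fv (es i)

def subst {X X' : Type} (σ : X → Exp S X') : BExp S X → BExp S X'
  | tt => tt
  | ff => ff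
  | not b => not (b.subst σ)
  | and b c => and (b.subst σ) (c.subst σ)
  | or b c => or (b.subst σ) (c.subst σ)
  | imp b c => imp (b.subst σ) (c.subst σ)
  | cmp o e e' => cmp o (FirstOrder.Language.Term.subst e σ) (FirstOrder.Language.Term.subst e' σ)
  | rel r es => rel r fun i => FirstOrder.Language.Term.subst (es i) σ

/-- Validity of `b → c`. -/
def Entails {X : Type} (b c : BExp S X) : Prop := ∀ ψ : X → ℝ, b.eval ψ → c.eval ψ

/-- Validity of `b → ⋁ B`, for an arbitrary collection `B`. -/
def EntailsSome {X : Type} (b : BExp S X) (B : Set (BExp S X)) : Prop :=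
  ∀ ψ : X → ℝ, b.eval ψ → ∃ c ∈ B, c.eval ψ

def Satisfiable {X : Type} (b : BExp S X) : Prop := ∃ ψ : X → ℝ, b.eval ψ

end BExp

variable (S)

/-- Channel names: classical or quantum. -/
abbrev Chan : Type := S.cChan ⊕ S.qChan

/-- One-to-one relabelling functions respecting the two kinds of channels. -/
structure Relabelling where
  onC : S.cChan ↪ S.cChan
  onQ : S.qChan ↪ S.qChan

/-- Process expressions whose free classical variables are among `X` and whose free quantum
variables are among `Y`. A binder is represented by the type `Option` in its body, where `none`
is the bound variable, so that α-convertible expressions are equal. -/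
inductive Proc : Type → Type → Type 1
  | nil {X Y : Type} : Proc X Y
  /-- `A(ẽ, q̃)` -/
  | con {X Y : Type} (A : S.Con) (e : Fin (S.arC A) → Exp S X) (q : Fin (S.arQ A) → Y) : Proc X Y
  | tau {X Y : Type} (t : Proc X Y) : Proc X Y
  /-- `c?x.t` -/
  | cin {X Y : Type} (c : S.cChan) (t : Proc (Option X) Y) : Proc X Y
  /-- `c!e.t` -/
  | cout {X Y : Type} (c : S.cChan) (e : Exp S X) (t : Proc X Y) : Proc X Y
  /-- `c?q.t` for a quantum channel `c` -/
  | qin {X Y : Type} (c : S.qChan) (t : Proc X (Option Y)) : Proc X Y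
  /-- `c!q.t` for a quantum channel `c` -/
  | qout {X Y : Type} (c : S.qChan) (q : Y) (t : Proc X Y) : Proc X Y
  /-- `E[q̃].t` -/
  | oper {X Y : Type} {n : ℕ} (E : CPt (Fin n)) (q : Fin n → Y) (t : Proc X Y) : Proc X Y
  /-- `M[q̃; x].t` -/
  | meas {X Y : Type} {n : ℕ} (M : Measurement n) (q : Fin n → Y) (t : Proc (Option X) Y) :
      Proc X Y
  | sum {X Y : Type} (t u : Proc X Y) : Proc X Y
  | par {X Y : Type} (t u : Proc X Y) : Proc X Y
  | res {X Y : Type} (t : Proc X Y) (L : Set (Chan S)) : Proc X Y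
  | rel {X Y : Type} (t : Proc X Y) (f : Relabelling S) : Proc X Y
  | ite {X Y : Type} (b : BExp S X) (t : Proc X Y) : Proc X Y

variable {S}

namespace Proc

/-- Free quantum variables. -/
def qv : {X Y : Type} → Proc S X Y → Set Y
  | _, _, nil => ∅
  | _, _, con _ _ q => Set.range q
  | _, _, tau t => t.qv
  | _, _, cin _ t => t.qv
  | _, _, cout _ _ t => t.qv
  | _, _, qin _ t => {y | some y ∈ t.qv}
  | _, _, qout _ q t => t.qv ∪ {q}
  | _, _, oper _ q t => t.qv ∪ Set.range q
  | _, _, meas _ q t => t.qv ∪ Set.range q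
  | _, _, sum t u => t.qv ∪ u.qv
  | _, _, par t u => t.qv ∪ u.qv
  | _, _, res t _ => t.qv
  | _, _, rel t _ => t.qv
  | _, _, ite _ t => t.qv

/-- Free classical variables. -/
def fv : {X Y : Type} → Proc S X Y → Set X
  | _, _, nil => ∅
  | _, _, con _ e _ => ⋃ i, Exp.fv (e i)
  | _, _, tau t => t.fv
  | _, _, cin _ t => {x | some x ∈ t.fv}
  | _, _, cout _ e t => Exp.fv e ∪ t.fv
  | _, _, qin _ t => t.fv
  | _, _, qout _ _ t => t.fv
  | _, _, oper _ _ t => t.fv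
  | _, _, meas _ _ t => {x | some x ∈ t.fv}
  | _, _, sum t u => t.fv ∪ u.fv
  | _, _, par t u => t.fv ∪ u.fv
  | _, _, res t _ => t.fv
  | _, _, rel t _ => t.fv
  | _, _, ite b t => b.fv ∪ t.fv

/-- The conditions on the use of quantum variables: tuples consist of distinct variables, a qubit
that has been sent is not used afterwards, and parallel processes share no qubits. -/
def WF : {X Y : Type} → Proc S X Y → Prop
  | _, _, nil => True
  | _, _, con _ _ q => Function.Injective q
  | _, _, tau t => t.WF
  | _, _, cin _ t => t.WF
  | _, _, cout _ _ t => t.WF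
  | _, _, qin _ t => t.WF
  | _, _, qout _ q t => q ∉ t.qv ∧ t.WF
  | _, _, oper _ q t => Function.Injective q ∧ t.WF
  | _, _, meas _ q t => Function.Injective q ∧ t.WF
  | _, _, sum t u => t.WF ∧ u.WF
  | _, _, par t u => Disjoint t.qv u.qv ∧ t.WF ∧ u.WF
  | _, _, res t _ => t.WF
  | _, _, rel t _ => t.WF
  | _, _, ite _ t => t.WF

/-- A substitution for classical variables, extended under a binder. -/
def up {X X' : Type} (σ : X → Exp S X') : Option X → Exp S (Option X')
  | none => FirstOrder.Language.Term.var none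
  | some x => FirstOrder.Language.Term.relabel some (σ x)

/-- Simultaneous substitution of expressions for the classical variables and of quantum variables
for the quantum variables. -/
def subst : {X Y : Type} → Proc S X Y → {X' Y' : Type} → (X → Exp S X') → (Y → Y') → Proc S X' Y'
  | _, _, nil, _, _, _, _ => nil
  | _, _, con A e q, _, _, σ, θ =>
      con A (fun i => FirstOrder.Language.Term.subst (e i) σ) (fun i => θ (q i))
  | _, _, tau t, _, _, σ, θ => tau (t.subst σ θ)
  | _, _, cin c t, _, _, σ, θ => cin c (t.subst (up σ) θ)
  | _, _, cout c e t, _, _, σ, θ => cout c (FirstOrder.Language.Term.subst e σ) (t.subst σ θ)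
  | _, _, qin c t, _, _, σ, θ => qin c (t.subst σ (Option.map θ))
  | _, _, qout c q t, _, _, σ, θ => qout c (θ q) (t.subst σ θ)
  | _, _, oper E q t, _, _, σ, θ => oper E (fun i => θ (q i)) (t.subst σ θ)
  | _, _, meas M q t, _, _, σ, θ => meas M (fun i => θ (q i)) (t.subst (up σ) θ)
  | _, _, sum t u, _, _, σ, θ => sum (t.subst σ θ) (u.subst σ θ)
  | _, _, par t u, _, _, σ, θ => par (t.subst σ θ) (u.subst σ θ)
  | _, _, res t L, _, _, σ, θ => res (t.subst σ θ) L
  | _, _, rel t f, _, _, σ, θ => rel (t.subst σ θ) f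
  | _, _, ite b t, _, _, σ, θ => ite (b.subst σ) (t.subst σ θ)

/-- The body of a binder for a classical variable, with the bound variable replaced by `e`. -/
def openC {X Y : Type} (t : Proc S (Option X) Y) (e : Exp S X) : Proc S X Y :=
  t.subst (fun o => o.elim e FirstOrder.Language.Term.var) id

/-- The body of a binder for a quantum variable, with the bound variable replaced by `r`. -/
def openQ {X Y : Type} (t : Proc S X (Option Y)) (r : Y) : Proc S X Y :=
  t.subst FirstOrder.Language.Term.var (fun o => o.getD r)

/-- `t{e/x}` -/
def substVar {X Y : Type} (t : Proc S X Y) (e : Exp S X) (x : X) : Proc S X Y :=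
  open Classical in t.subst (Function.update FirstOrder.Language.Term.var x e) id

end Proc

variable (S)

/-- Defining equations of the process constants. In the body of a constant only its formal
parameters, numbered by `Fin`, may occur free. -/
structure DefEqs where
  body (A : S.Con) : Proc S (Fin (S.arC A)) (Fin (S.arQ A))
  wf (A : S.Con) : (body A).WF

/-! ## Symbolic semantics -/

/-- The symbolic actions. -/
inductive Act : Type
  | tau : Act
  | cin : S.cChan → S.cVar → Act
  | cout : S.cChan → Exp S S.cVar → Act
  | qin : S.qChan → S.qVar → Act
  | qout : S.qChan → S.qVar → Act

variable {S}

namespace Act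

/-- Bound classical variables. -/
def bv : Act S → Set S.cVar
  | cin _ x => {x}
  | _ => ∅

/-- Bound quantum variables. -/
def qbv : Act S → Set S.qVar
  | qin _ r => {r}
  | _ => ∅

/-- Channel names. -/
def cn : Act S → Set (Chan S)
  | tau => ∅
  | cin c _ => {Sum.inl c}
  | cout c _ => {Sum.inl c}
  | qin c _ => {Sum.inr c}
  | qout c _ => {Sum.inr c}

def relabel (f : Relabelling S) : Act S → Act S
  | tau => tau
  | cin c x => cin (f.onC c) x
  | cout c e => cout (f.onC c) e
  | qin c r => qin (f.onQ c) r
  | qout c r => qout (f.onQ c) r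

/-- `γ =_b γ'`: equality, except that for classical outputs on the same channel it suffices that
`b` implies the equality of the values sent. -/
def EqUnder (b : BExp S S.cVar) : Act S → Act S → Prop
  | cout c e, γ' => ∃ e', γ' = cout c e' ∧ b.Entails (BExp.cmp Cmp.eq e e')
  | γ, γ' => γ = γ'

end Act

variable (S)

/-- Pairs of a process expression, not yet required to be well-formed, and a trace-preserving
super-operator. -/
abbrev Pre : Type 1 := Proc S S.cVar S.qVar × CPt S.qVar

/-- The process terms. -/
abbrev Term : Type 1 := {t : Proc S S.cVar S.qVar // t.WF}

/-- The snapshots. -/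
abbrev Snap : Type 1 := Term S × CPt S.qVar

variable {S}

/-- Apply a process construct in every state of a distribution. -/
def mapProc (F : Proc S S.cVar S.qVar → Proc S S.cVar S.qVar) (Δ : SVal S.qVar (Pre S)) :
    SVal S.qVar (Pre S) :=
  Δ.mapDomain fun s => (F s.1, s.2)

/-- The distribution concentrated in `s` with the identity super-operator as weight. -/
def point (s : Pre S) : SVal S.qVar (Pre S) := Finsupp.single s 1

/-- The rules of the symbolic semantics. -/
inductive Trans (D : DefEqs S) :
    Pre S → BExp S S.cVar → Act S → SVal S.qVar (Pre S) → Prop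
  | tau (t : Proc S S.cVar S.qVar) (E : CPt S.qVar) :
      Trans D (t.tau, E) .tt .tau (point (t, E))
  | cin (c : S.cChan) (t : Proc S (Option S.cVar) S.qVar) (E : CPt S.qVar) (x : S.cVar)
      (hx : x ∉ (t.cin c).fv) :
      Trans D (t.cin c, E) .tt (.cin c x) (point (t.openC (FirstOrder.Language.Term.var x), E))
  | cout (c : S.cChan) (e : Exp S S.cVar) (t : Proc S S.cVar S.qVar) (E : CPt S.qVar) :
      Trans D (t.cout c e, E) .tt (.cout c e) (point (t, E))
  | qin (c : S.qChan) (t : Proc S S.cVar (Option S.qVar)) (E : CPt S.qVar) (r : S.qVar)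
      (hr : r ∉ (t.qin c).qv) :
      Trans D (t.qin c, E) .tt (.qin c r) (point (t.openQ r, E))
  | qout (c : S.qChan) (q : S.qVar) (t : Proc S S.cVar S.qVar) (E : CPt S.qVar) :
      Trans D (t.qout c q, E) .tt (.qout c q) (point (t, E))
  | oper {n : ℕ} (F : CPt (Fin n)) (q : Fin n ↪ S.qVar) (t : Proc S S.cVar S.qVar)
      (E F' : CPt S.qVar) (hF : Extends q F.1.1 F'.1.1) :
      Trans D (t.oper F q, E) .tt .tau (point (t, F' * E))
  /-- `M = ∑ᵢ lam i |φ i⟩⟨φ i|`, `A i` is `ρ ↦ |φ i⟩⟨φ i| ρ |φ i⟩⟨φ i|` performed on `q`, and `R i`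
  is `ρ ↦ ∑ⱼ |φ i⟩⟨φ j| ρ |φ j⟩⟨φ i|` performed on `q`. -/
  | meas {n : ℕ} (M : Measurement n) (q : Fin n ↪ S.qVar) (t : Proc S (Option S.cVar) S.qVar)
      (E : CPt S.qVar) (φ : OrthonormalBasis (Fin (2 ^ n)) ℂ (Hilb (Fin n)))
      (lam : Fin (2 ^ n) → ℝ) (hM : ∀ i, M.op (φ i) = (lam i : ℂ) • φ i)
      (A : Fin (2 ^ n) → CP S.qVar) (R : Fin (2 ^ n) → CPt S.qVar)
      (hA : ∀ i, Extends q (conj (InnerProductSpace.rankOne ℂ (φ i) (φ i))) (A i).1)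
      (hR : ∀ i, Extends q (∑ j, conj (InnerProductSpace.rankOne ℂ (φ i) (φ j))) (R i).1.1) :
      Trans D (t.meas M q, E) .tt .tau
        (∑ i, Finsupp.single (t.openC (Exp.const (lam i)), R i * E) (A i))
  | sumL {t u : Proc S S.cVar S.qVar} {E : CPt S.qVar} {b : BExp S S.cVar} {γ : Act S}
      {Δ : SVal S.qVar (Pre S)} (h : Trans D (t, E) b γ Δ) : Trans D (t.sum u, E) b γ Δ
  | sumR {t u : Proc S S.cVar S.qVar} {E : CPt S.qVar} {b : BExp S S.cVar} {γ : Act S}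
      {Δ : SVal S.qVar (Pre S)} (h : Trans D (u, E) b γ Δ) : Trans D (t.sum u, E) b γ Δ
  | parL {t u : Proc S S.cVar S.qVar} {E : CPt S.qVar} {b : BExp S S.cVar} {γ : Act S}
      {Δ : SVal S.qVar (Pre S)} (h : Trans D (t, E) b γ Δ)
      (hc : Disjoint γ.bv u.fv) (hq : Disjoint γ.qbv u.qv) :
      Trans D (t.par u, E) b γ (mapProc (fun t' => t'.par u) Δ)
  | parR {t u : Proc S S.cVar S.qVar} {E : CPt S.qVar} {b : BExp S S.cVar} {γ : Act S}
      {Δ : SVal S.qVar (Pre S)} (h : Trans D (u, E) b γ Δ)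
      (hc : Disjoint γ.bv t.fv) (hq : Disjoint γ.qbv t.qv) :
      Trans D (t.par u, E) b γ (mapProc (fun u' => t.par u') Δ)
  | ccomL {t u t' u' : Proc S S.cVar S.qVar} {E : CPt S.qVar} {b₁ b₂ : BExp S S.cVar}
      {c : S.cChan} {x : S.cVar} {e : Exp S S.cVar}
      (h₁ : Trans D (t, E) b₁ (.cin c x) (point (t', E)))
      (h₂ : Trans D (u, E) b₂ (.cout c e) (point (u', E))) :
      Trans D (t.par u, E) (b₁.and b₂) .tau (point ((t'.substVar e x).par u', E))
  | ccomR {t u t' u' : Proc S S.cVar S.qVar} {E : CPt S.qVar} {b₁ b₂ : BExp S S.cVar}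
      {c : S.cChan} {x : S.cVar} {e : Exp S S.cVar}
      (h₁ : Trans D (t, E) b₁ (.cout c e) (point (t', E)))
      (h₂ : Trans D (u, E) b₂ (.cin c x) (point (u', E))) :
      Trans D (t.par u, E) (b₁.and b₂) .tau (point (t'.par (u'.substVar e x), E))
  | qcomL {t u t' u' : Proc S S.cVar S.qVar} {E : CPt S.qVar} {b₁ b₂ : BExp S S.cVar}
      {c : S.qChan} {r : S.qVar}
      (h₁ : Trans D (t, E) b₁ (.qin c r) (point (t', E)))
      (h₂ : Trans D (u, E) b₂ (.qout c r) (point (u', E))) :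
      Trans D (t.par u, E) (b₁.and b₂) .tau (point (t'.par u', E))
  | qcomR {t u t' u' : Proc S S.cVar S.qVar} {E : CPt S.qVar} {b₁ b₂ : BExp S S.cVar}
      {c : S.qChan} {r : S.qVar}
      (h₁ : Trans D (t, E) b₁ (.qout c r) (point (t', E)))
      (h₂ : Trans D (u, E) b₂ (.qin c r) (point (u', E))) :
      Trans D (t.par u, E) (b₁.and b₂) .tau (point (t'.par u', E))
  | res {t : Proc S S.cVar S.qVar} {E : CPt S.qVar} {b : BExp S S.cVar} {γ : Act S}
      {Δ : SVal S.qVar (Pre S)} {L : Set (Chan S)} (h : Trans D (t, E) b γ Δ)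
      (hL : Disjoint γ.cn L) : Trans D (t.res L, E) b γ (mapProc (fun t' => t'.res L) Δ)
  | rel {t : Proc S S.cVar S.qVar} {E : CPt S.qVar} {b : BExp S S.cVar} {γ : Act S}
      {Δ : SVal S.qVar (Pre S)} {f : Relabelling S} (h : Trans D (t, E) b γ Δ) :
      Trans D (t.rel f, E) b (γ.relabel f) (mapProc (fun t' => t'.rel f) Δ)
  | ite {t : Proc S S.cVar S.qVar} {E : CPt S.qVar} {b b₁ : BExp S S.cVar} {γ : Act S}
      {Δ : SVal S.qVar (Pre S)} (h : Trans D (t, E) b₁ γ Δ) :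
      Trans D (t.ite b, E) (b.and b₁) γ Δ
  | con {A : S.Con} {e : Fin (S.arC A) → Exp S S.cVar} {q : Fin (S.arQ A) → S.qVar}
      {E : CPt S.qVar} {b : BExp S S.cVar} {γ : Act S} {Δ : SVal S.qVar (Pre S)}
      (h : Trans D ((D.body A).subst e q, E) b γ Δ) : Trans D (Proc.con A e q, E) b γ Δ

/-- The transition relation on snapshots. It is the restriction of the relation given by the rules:
a well-formed term only has transitions to distributions over well-formed terms, since an input
never reads a qubit that a parallel component owns, and a qubit that was sent is no longer free. -/
def Step (D : DefEqs S) (s : Snap S) (b : BExp S S.cVar) (γ : Act S) (Δ : SVal S.qVar (Snap S)) :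
    Prop :=
  IsDist Δ ∧ Trans D (s.1.1, s.2) b γ (Δ.mapDomain fun s' => (s'.1.1, s'.2))

/-! ## Symbolic bisimulation -/

/-- Symbolic (open) bisimulations. -/
def IsSymbolicBisimulation (D : DefEqs S) (R : BExp S S.cVar → Snap S → Snap S → Prop) : Prop :=
  (∀ b, Equivalence (R b)) ∧
  ∀ (b : BExp S S.cVar) (t u : Term S) (E F : CPt S.qVar), R b (t, E) (u, F) →
    (b.Satisfiable → t.1.qv = u.1.qv ∧ EqOn (t.1.qv)ᶜ E.1 F.1) ∧
    ∀ G : CPt S.qVar, ActsOn (t.1.qv)ᶜ G →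
      ∀ (b₁ : BExp S S.cVar) (γ : Act S) (Δ : SVal S.qVar (Snap S)),
        Step D (t, G * E) b₁ γ Δ → Disjoint γ.bv (b.fv ∪ t.1.fv ∪ u.1.fv) →
        ∃ B : Set (BExp S S.cVar), (b.and b₁).EntailsSome B ∧
          ∀ b' ∈ B, ∃ (b₂ : BExp S S.cVar) (γ' : Act S) (Ξ : SVal S.qVar (Snap S)),
            b'.Entails b₂ ∧ Act.EqUnder b' γ γ' ∧ Step D (u, G * F) b₂ γ' Ξ ∧
            Lift (R b') (combine (G * E).1 Δ) (combine (G * F).1 Ξ)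

/-- Symbolic `b`-bisimilarity. -/
def Bisimilar (D : DefEqs S) (b : BExp S S.cVar) (s s' : Snap S) : Prop :=
  ∃ R, IsSymbolicBisimulation D R ∧ R b s s'

end QCCS

end

noncomputable section

namespace QCCS

variable {S : Signature}

/-! ## Substitution and renaming of classical variables -/

section Terms

open FirstOrder.Language

variable {L : FirstOrder.Language} {X X' X'' : Type}

/-! Composing two symbolic bisimulations does not visibly give another: the result need not be an
equivalence, and the conditions produced by the two matches differ. So all bisimulations are merged
at once. `Chain D c` joins two snapshots by finitely many links, each taken from some bisimulation
at some condition `b` with `c → b`. It is an equivalence, contains every bisimulation, and grows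
when `c` is strengthened. Once it is shown to be a symbolic bisimulation itself, it coincides with
`Bisimilar D`, and every claim follows.

A transition is matched along a chain link by link (`Chain.exists_simulates`). If one link answers
under `b'` and the next under `b''`, the composite answers under `b' ∧ b''` (`Matches.trans`): both
liftings pass to the coarser equivalence `Chain D (b' ∧ b'')` and compose there. Coarsening is sound
because a coarse class is a union of fine ones, so its weight is a finite sum of theirs
(`weight_eq_of_coarser`). Since `≂` compares weights through reduced states, this needs the partial
trace to be additive. The partial trace is an infinite sum of blocks, which converges absolutely by
Bessel and Cauchy–Schwarz (`summable_block`).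

The remaining obstacle is the side condition on input variables: the variable avoids the two ends of
the chain and `c`, but it may occur free in an intermediate snapshot or link condition. Only
finitely many variables are harmful, so the input variable is swapped with a fresh one by a
permutation fixing `c` and both ends (`Simulates.of_finite`). This is legitimate because the
semantics is equivariant (`Trans.rename`), hence permutations carry bisimulations to bisimulations
and chains to chains (`Chain.rename_iff`). -/

theorem term_subst_subst (e : L.Term X) (σ : X → L.Term X') (σ' : X' → L.Term X'') :
    (e.subst σ).subst σ' = e.subst fun x => (σ x).subst σ' := by
  induction e with
  | var => rfl
  | func f ts ih => simp [Term.subst, ih]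

theorem term_relabel_subst (e : L.Term X) (g : X → X') (σ : X' → L.Term X'') :
    (e.relabel g).subst σ = e.subst fun x => σ (g x) := by
  induction e with
  | var => rfl
  | func f ts ih => simp [Term.subst, Term.relabel, ih]

theorem term_subst_relabel (e : L.Term X) (σ : X → L.Term X') (g : X' → X'') :
    (e.subst σ).relabel g = e.subst fun x => (σ x).relabel g := by
  induction e with
  | var => rfl
  | func f ts ih => simp [Term.subst, Term.relabel, ih]

theorem term_subst_eq_self [DecidableEq X] (e : L.Term X) (σ : X → L.Term X)
    (h : ∀ x ∈ e.varFinset, σ x = Term.var x) : e.subst σ = e := by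
  induction e with
  | var x => exact h x (by simp [Term.varFinset])
  | func f ts ih =>
    simp only [Term.subst, Term.func.injEq, heq_eq_eq, true_and]
    funext i
    exact ih i fun x hx => h x (by simpa [Term.varFinset] using ⟨i, hx⟩)

theorem term_varFinset_rename [DecidableEq X] [DecidableEq X'] (e : L.Term X) (π : X → X') :
    (e.subst fun x => Term.var (π x)).varFinset = e.varFinset.image π := by
  induction e with
  | var x => simp [Term.subst, Term.varFinset]
  | func f ts ih => ext; simp [Term.subst, Term.varFinset, ih]; grind

end Terms

theorem Exp.mem_fv {X : Type} [DecidableEq X] (e : Exp S X) (x : X) :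
    x ∈ Exp.fv e ↔ x ∈ e.varFinset := by
  rw [Exp.fv, Set.mem_ofPred_eq]
  congr!

theorem Exp.subst_eq_self {X : Type} (e : Exp S X) (σ : X → Exp S X)
    (h : ∀ x ∈ Exp.fv e, σ x = FirstOrder.Language.Term.var x) :
    FirstOrder.Language.Term.subst e σ = e := by
  classical
  exact term_subst_eq_self e σ fun x hx => h x ((Exp.mem_fv e x).2 hx)

theorem Exp.fv_rename {X X' : Type} (e : Exp S X) (π : X → X') :
    Exp.fv (S := S) (FirstOrder.Language.Term.subst e fun x => .var (π x)) = π '' Exp.fv e := by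
  classical
  ext y
  simp [Exp.mem_fv, term_varFinset_rename]

theorem Exp.finite_fv {X : Type} (e : Exp S X) : (Exp.fv e).Finite := by
  classical
  exact e.varFinset.finite_toSet.subset fun x hx => (Exp.mem_fv e x).1 hx

/-! ### Renaming in boolean expressions -/

namespace BExp

variable {X X' X'' : Type}

/-- Renaming of the variables of a boolean expression. -/
def rename (π : X → X') (b : BExp S X) : BExp S X' :=
  b.subst fun x => .var (π x)

theorem subst_subst (b : BExp S X) (σ : X → Exp S X') (σ' : X' → Exp S X'') :
    (b.subst σ).subst σ' = b.subst fun x => FirstOrder.Language.Term.subst (σ x) σ' := by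
  induction b <;> simp_all [subst, term_subst_subst]

theorem subst_eq_self (b : BExp S X) (σ : X → Exp S X)
    (h : ∀ x ∈ b.fv, σ x = .var x) : b.subst σ = b := by
  induction b with
  | tt => rfl
  | ff => rfl
  | not b ih => simp only [subst]; rw [ih h]
  | and b c ihb ihc =>
    simp only [subst]; rw [ihb fun x hx => h x (.inl hx), ihc fun x hx => h x (.inr hx)]
  | or b c ihb ihc =>
    simp only [subst]; rw [ihb fun x hx => h x (.inl hx), ihc fun x hx => h x (.inr hx)]
  | imp b c ihb ihc =>
    simp only [subst]; rw [ihb fun x hx => h x (.inl hx), ihc fun x hx => h x (.inr hx)]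
  | cmp o e e' =>
    simp only [subst]
    rw [Exp.subst_eq_self e σ fun x hx => h x (.inl hx),
      Exp.subst_eq_self e' σ fun x hx => h x (.inr hx)]
  | rel r es =>
    simp only [subst]
    congr 1
    funext i
    exact Exp.subst_eq_self _ σ fun x hx => h x (Set.mem_iUnion.2 ⟨i, hx⟩)

theorem eval_rename (π : X → X') (b : BExp S X) (ψ : X' → ℝ) :
    (b.rename π).eval ψ ↔ b.eval (ψ ∘ π) := by
  induction b with
  | cmp | rel =>
    simp [rename, subst, eval, Exp.eval, Function.comp_def]
  | _ => simp_all [rename, subst, eval]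

theorem fv_rename (π : X → X') (b : BExp S X) : (b.rename π).fv = π '' b.fv := by
  induction b with
  | cmp | rel => simp [rename, subst, fv, Exp.fv_rename, Set.image_union, Set.image_iUnion]
  | _ => simp_all [rename, subst, fv, Set.image_union]

theorem finite_fv (b : BExp S X) : b.fv.Finite := by
  induction b with
  | tt | ff => exact Set.finite_empty
  | not b ih => exact ih
  | and b c ihb ihc | or b c ihb ihc | imp b c ihb ihc => exact ihb.union ihc
  | cmp => exact (Exp.finite_fv _).union (Exp.finite_fv _)
  | rel => exact Set.finite_iUnion fun _ => Exp.finite_fv _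

theorem rename_eq_self (π : X → X) (b : BExp S X) (h : ∀ x ∈ b.fv, π x = x) :
    b.rename π = b :=
  b.subst_eq_self _ fun x hx => by rw [h x hx]

theorem rename_rename (π : X → X') (π' : X' → X'') (b : BExp S X) :
    (b.rename π).rename π' = b.rename (π' ∘ π) := by
  simp [rename, subst_subst, FirstOrder.Language.Term.subst]

theorem rename_symm_rename (π : X ≃ X') (b : BExp S X) : (b.rename π).rename π.symm = b := by
  rw [rename_rename]
  exact b.rename_eq_self _ (by simp)

theorem rename_rename_symm (π : X ≃ X') (b : BExp S X') : (b.rename π.symm).rename π = b :=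
  rename_symm_rename π.symm b

theorem Entails.rename {b c : BExp S X} (h : b.Entails c) (π : X → X') :
    (b.rename π).Entails (c.rename π) := fun ψ hb =>
  (eval_rename π c ψ).2 (h _ ((eval_rename π b ψ).1 hb))

end BExp

/-! ### Substitution and renaming in process expressions -/

namespace Proc

variable {X X' X'' Y Y' Y'' : Type}

theorem subst_up_up (σ : X → Exp S X') (σ' : X' → Exp S X'') (o : Option X) :
    FirstOrder.Language.Term.subst (up σ o) (up σ')
      = up (fun x => FirstOrder.Language.Term.subst (σ x) σ') o := by
  cases o with
  | none => rfl
  | some x => simp [up, term_relabel_subst, term_subst_relabel]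

/-- The target types and the substitutions are quantified after the term because, under a binder,
the induction hypothesis is needed for lifted substitutions between `Option` types. -/
theorem subst_subst (t : Proc S X Y) : ∀ {X' Y' X'' Y'' : Type} (σ : X → Exp S X') (θ : Y → Y')
    (σ' : X' → Exp S X'') (θ' : Y' → Y''),
    (t.subst σ θ).subst σ' θ'
      = t.subst (fun x => FirstOrder.Language.Term.subst (σ x) σ') (θ' ∘ θ) := by
  induction t with
  | nil => intros; rfl
  | con A e q => intros; simp [subst, term_subst_subst]
  | tau t ih | res t L ih | rel t f ih | qout c q t ih | oper E q t ih =>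
    intros; simp only [subst, ih, Function.comp_apply]
  | cin c t ih | meas M q t ih =>
    intros; simp only [subst, ih, Function.comp_apply, subst_up_up]
  | cout c e t ih => intros; simp only [subst, ih, term_subst_subst]
  | qin c t ih => intros; simp only [subst, ih, Option.map_comp_map]
  | sum t u iht ihu | par t u iht ihu => intros; simp only [subst, iht, ihu]
  | ite b t ih => intros; simp only [subst, ih, BExp.subst_subst]

theorem subst_eq_self (t : Proc S X Y) (σ : X → Exp S X) (h : ∀ x ∈ t.fv, σ x = .var x) :
    t.subst σ id = t := by
  -- Under a binder, the lifted substitution again fixes every free variable of the body, so the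
  -- induction hypothesis applies.
  have up_eq : ∀ {X Y : Type} (t : Proc S (Option X) Y) (σ : X → Exp S X),
      (∀ x, some x ∈ t.fv → σ x = .var x) → ∀ o ∈ t.fv, up σ o = .var o := by
    intro X Y t σ h o ho
    cases o with
    | none => rfl
    | some x => simp [up, h x ho, FirstOrder.Language.Term.relabel]
  induction t with
  | nil => rfl
  | con A e q =>
    simp only [subst, con.injEq, heq_eq_eq, true_and]
    exact ⟨funext fun i => Exp.subst_eq_self _ σ fun x hx => h x (Set.mem_iUnion.2 ⟨i, hx⟩), rfl⟩
  | tau t ih => simp only [subst]; rw [ih σ h]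
  | cin c t ih => simp only [subst]; rw [ih _ (up_eq t σ h)]
  | cout c e t ih =>
    simp only [subst]
    rw [Exp.subst_eq_self e σ fun x hx => h x (.inl hx), ih σ fun x hx => h x (.inr hx)]
  | qin c t ih => simp only [subst, Option.map_id]; rw [ih σ h]
  | qout c q t ih => simp only [subst]; rw [ih σ h]; rfl
  | oper E q t ih => simp only [subst]; rw [ih σ h]; rfl
  | meas M q t ih => simp only [subst]; rw [ih _ (up_eq t σ h)]; rfl
  | sum t u iht ihu =>
    simp only [subst]; rw [iht σ fun x hx => h x (.inl hx), ihu σ fun x hx => h x (.inr hx)]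
  | par t u iht ihu =>
    simp only [subst]; rw [iht σ fun x hx => h x (.inl hx), ihu σ fun x hx => h x (.inr hx)]
  | res t L ih => simp only [subst]; rw [ih σ h]
  | rel t f ih => simp only [subst]; rw [ih σ h]
  | ite b t ih =>
    simp only [subst]
    rw [b.subst_eq_self σ fun x hx => h x (.inl hx), ih σ fun x hx => h x (.inr hx)]

theorem qv_subst (t : Proc S X Y) : ∀ {X' : Type} (σ : X → Exp S X'),
    (t.subst σ id).qv = t.qv := by
  induction t <;> intros <;> simp_all [subst, qv]

theorem wf_subst (t : Proc S X Y) : ∀ {X' : Type} (σ : X → Exp S X'),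
    t.WF → (t.subst σ id).WF := by
  induction t <;> intros <;> simp_all [subst, WF, qv_subst]

/-- Renaming of the classical variables of a process expression. -/
def rename (π : X → X') (t : Proc S X Y) : Proc S X' Y := t.subst (fun x => .var (π x)) id

theorem up_var (π : X → X') :
    up (S := S) (fun x => .var (π x)) = fun o => .var (Option.map π o) := by
  funext o
  cases o <;> rfl

theorem fv_rename (t : Proc S X Y) : ∀ {X' : Type} (π : X → X'), (t.rename π).fv = π '' t.fv := by
  -- Removing the bound variable `none` commutes with taking images, because `Option.map π` sends
  -- only `none` to `none`.
  have aux : ∀ {X X' : Type} (π : X → X') (A : Set (Option X)),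
      {x | some x ∈ Option.map π '' A} = π '' {x | some x ∈ A} := by
    intro X X' π A
    ext y
    constructor
    · rintro ⟨_ | x, hx, hy⟩
      · simp at hy
      · exact ⟨x, hx, by simpa using hy⟩
    · rintro ⟨x, hx, rfl⟩
      exact ⟨some x, hx, rfl⟩
  induction t with
  | nil => intro _ π; simp [rename, subst, fv]
  | con A e q => intro _ π; simp [rename, subst, fv, Exp.fv_rename, Set.image_iUnion]
  | cin c t ih | meas M q t ih =>
    intro _ π
    rw [rename, subst, fv, fv, up_var, ← aux, ← ih]
    rfl
  | cout c e t ih =>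
    intro _ π
    rw [rename, subst, fv, fv, Exp.fv_rename, Set.image_union, ← ih]
    rfl
  | sum t u iht ihu | par t u iht ihu =>
    intro _ π
    rw [rename, subst, fv, fv, Set.image_union, ← iht, ← ihu]
    rfl
  | qin c t ih =>
    intro _ π
    rw [rename, subst, fv, fv, ← ih, Option.map_id]
    rfl
  | ite b t ih =>
    intro _ π
    rw [rename, subst, fv, fv, Set.image_union, ← ih, ← BExp.fv_rename]
    rfl
  | tau t ih | qout c q t ih | oper E q t ih | res t L ih | rel t f ih =>
    intro _ π
    rw [rename, subst, fv, fv, ← ih]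
    rfl

theorem finite_fv (t : Proc S X Y) : t.fv.Finite := by
  induction t with
  | nil => exact Set.finite_empty
  | con => exact Set.finite_iUnion fun _ => Exp.finite_fv _
  | cin c t ih | meas M q t ih => exact ih.preimage (Option.some_injective _).injOn
  | cout c e t ih => exact (Exp.finite_fv e).union ih
  | sum t u iht ihu | par t u iht ihu => exact iht.union ihu
  | ite b t ih => exact b.finite_fv.union ih
  | tau t ih | qin c t ih | qout c q t ih | oper E q t ih | res t L ih | rel t f ih => exact ih

theorem rename_eq_self (π : X → X) (t : Proc S X Y) (h : ∀ x ∈ t.fv, π x = x) :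
    t.rename π = t :=
  t.subst_eq_self _ fun x hx => by rw [h x hx]

theorem qv_rename (π : X → X') (t : Proc S X Y) : (t.rename π).qv = t.qv := qv_subst t _

theorem WF.rename {t : Proc S X Y} (h : t.WF) (π : X → X') : (t.rename π).WF := wf_subst t _ h

theorem rename_rename (π : X → X') (π' : X' → X'') (t : Proc S X Y) :
    (t.rename π).rename π' = t.rename (π' ∘ π) := by
  simp [Proc.rename, subst_subst, FirstOrder.Language.Term.subst]

theorem rename_symm_rename (π : X ≃ X') (t : Proc S X Y) : (t.rename π).rename π.symm = t := by
  rw [rename_rename]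
  exact t.rename_eq_self _ (by simp)

theorem rename_openC (π : X → X') (t : Proc S (Option X) Y) (e : Exp S X) :
    (t.openC e).rename π = (t.subst (up fun x => .var (π x)) id).openC
      (FirstOrder.Language.Term.subst e fun x => .var (π x)) := by
  rw [openC, openC, Proc.rename, subst_subst, subst_subst]
  congr 1
  funext o
  cases o <;> rfl

theorem rename_openQ (π : X → X') (t : Proc S X (Option Y)) (r : Y) :
    (t.openQ r).rename π = (t.subst (fun x => .var (π x)) (Option.map id)).openQ r := by
  rw [openQ, openQ, Proc.rename, subst_subst, subst_subst, Option.map_id]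
  rfl

/-- Injectivity of `π` is essential: no variable other than `x` may be sent to `π x`, where the
right-hand side substitutes. -/
theorem rename_substVar (π : X ≃ X') (t : Proc S X Y) (e : Exp S X) (x : X) :
    (t.substVar e x).rename π
      = (t.rename π).substVar (FirstOrder.Language.Term.subst e fun x => .var (π x)) (π x) := by
  classical
  rw [substVar, substVar, Proc.rename, Proc.rename, subst_subst, subst_subst]
  congr 1
  funext y
  by_cases h : y = x
  · subst h; simp [FirstOrder.Language.Term.subst]
  · simp [FirstOrder.Language.Term.subst, h]

end Proc

/-! ## Additivity of the partial trace, and the lifting of relations -/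

section PartialTrace

variable {Q : Type}

/-- The first component vanishes on the range of `e` and the embedded second one off it, so their
sum determines both. Hence the vectors `v ⊗ |k⟩`, for all basis vectors `v` and all `k` together,
form one orthonormal family. -/
theorem glue_uncurry_injective {Q' : Type} (e : Q' ↪ Q) :
    Function.Injective fun p : Rest e × (Q' →₀ Fin 2) => glue e p.1 p.2 := by
  rintro ⟨k, f⟩ ⟨k', f'⟩ h
  have hk : k = k' := by
    ext1
    ext1 q
    by_cases hq : q ∈ Set.range e
    · obtain ⟨q', rfl⟩ := hq
      rw [k.2, k'.2]
    · have := DFunLike.congr_fun h q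
      simpa [glue, Finsupp.embDomain_of_notMem_range _ _ _ hq] using this
  subst hk
  exact Prod.ext rfl (glue_injective e k h)

theorem ketR_stdBasis {Q' : Type} (e : Q' ↪ Q) (k : Rest e) (f : Q' →₀ Fin 2) :
    ketR e k (stdBasis Q' f) = stdBasis Q (glue e k f) := by
  classical
  have : stdBasis Q' f = lp.single (E := fun _ : Q' →₀ Fin 2 => ℂ) 2 f (1 : ℂ) := by
    rw [← (stdBasis Q').repr_symm_single]
    rfl
  rw [this]
  simp [ketR]

theorem hasSum_norm_sq_inner_stdBasis (u : Hilb Q) :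
    HasSum (fun f => ‖⟪stdBasis Q f, u⟫_ℂ‖ ^ 2) (‖u‖ ^ 2) := by
  have h := (stdBasis Q).hasSum_inner_mul_inner u u
  rw [inner_self_eq_norm_sq_to_K] at h
  have h' : (fun f => ⟪u, stdBasis Q f⟫_ℂ * ⟪stdBasis Q f, u⟫_ℂ)
      = fun f => ((‖⟪stdBasis Q f, u⟫_ℂ‖ ^ 2 : ℝ) : ℂ) := by
    funext f
    rw [← inner_conj_symm, RCLike.conj_mul]
    simp
  rw [h'] at h
  exact Complex.hasSum_ofReal.1 (by simpa using h)

/-- By Parseval, each term is the sum of the squared coefficients of `u` along the basis vectors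
glued with `k`; Bessel's inequality for the joint orthonormal family bounds the total. -/
theorem sum_norm_sq_adjoint_ketR_le {Q' : Type} (e : Q' ↪ Q) (s : Finset (Rest e)) (u : Hilb Q) :
    ∑ k ∈ s, ‖adjoint (ketR e k) u‖ ^ 2 ≤ ‖u‖ ^ 2 := by
  have ho := (stdBasis Q).orthonormal.comp _ (glue_uncurry_injective e)
  have hs := ho.inner_products_summable u
  have hk : ∀ k, ‖adjoint (ketR e k) u‖ ^ 2 = ∑' f, ‖⟪stdBasis Q (glue e k f), u⟫_ℂ‖ ^ 2 := by
    intro k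
    rw [← (hasSum_norm_sq_inner_stdBasis _).tsum_eq]
    simp only [ContinuousLinearMap.adjoint_inner_right, ketR_stdBasis]
  calc ∑ k ∈ s, ‖adjoint (ketR e k) u‖ ^ 2
      ≤ ∑' k, ∑' f, ‖⟪stdBasis Q (glue e k f), u⟫_ℂ‖ ^ 2 := by
        simp only [hk]
        exact hs.prod.sum_le_tsum s fun k _ => tsum_nonneg fun f => by positivity
    _ ≤ ‖u‖ ^ 2 := by
        refine (hs.tsum_prod).symm.trans_le ?_
        exact ho.tsum_inner_products_le u

theorem norm_le_tsum_of_nuclear {E F : Type} [NormedAddCommGroup E] [InnerProductSpace ℂ E]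
    [NormedAddCommGroup F] [InnerProductSpace ℂ F] {A : E →L[ℂ] F} {u : ℕ → F} {v : ℕ → E}
    (hs : Summable fun n => ‖u n‖ * ‖v n‖) (h : ∀ x, HasSum (fun n => ⟪v n, x⟫_ℂ • u n) (A x)) :
    ‖A‖ ≤ ∑' n, ‖u n‖ * ‖v n‖ := by
  refine A.opNorm_le_bound (tsum_nonneg fun n => by positivity) fun x => ?_
  rw [← tsum_mul_right, ← (h x).tsum_eq]
  refine tsum_of_norm_bounded (hs.mul_right ‖x‖).hasSum fun n => ?_
  rw [norm_smul, mul_comm, mul_assoc]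
  gcongr
  exact norm_inner_le_norm _ _

/-- Needed because `tsum` is `0` on families that are not summable, so that `ptrace` would otherwise
not be visibly additive. In a nuclear expansion of `ρ`, each block compresses the vectors `u n` and
`v n`; Cauchy–Schwarz over `k` and Bessel bound the sum of the block norms by `∑ ‖u n‖ ‖v n‖`. -/
theorem summable_block (V : Set Q) (ρ : TC Q) :
    Summable fun k : Rest (Function.Embedding.subtype (· ∈ V)) => (block _ k k ρ).1 := by
  obtain ⟨u, v, hs, h⟩ := ρ.2
  let K := fun k : Rest (Function.Embedding.subtype (· ∈ V)) => adjoint (ketR _ k)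
  have hsum : ∀ s, ∀ n, ∑ k ∈ s, ‖K k (u n)‖ * ‖K k (v n)‖ ≤ ‖u n‖ * ‖v n‖ := by
    intro s n
    refine (Real.sum_mul_le_sqrt_mul_sqrt s _ _).trans ?_
    gcongr
    · exact Real.sqrt_le_iff.2 ⟨norm_nonneg _, sum_norm_sq_adjoint_ketR_le _ s _⟩
    · exact Real.sqrt_le_iff.2 ⟨norm_nonneg _, sum_norm_sq_adjoint_ketR_le _ s _⟩
  have hk : ∀ k, Summable fun n => ‖K k (u n)‖ * ‖K k (v n)‖ := fun k =>
    hs.of_nonneg_of_le (fun n => by positivity) fun n => by simpa using hsum {k} n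
  have hle : ∀ k, ‖(block _ k k ρ).1‖ ≤ ∑' n, ‖K k (u n)‖ * ‖K k (v n)‖ := fun k =>
    norm_le_tsum_of_nuclear (hk k) fun x => by
      simpa [K, block, ContinuousLinearMap.adjoint_inner_left] using (h (ketR _ k x)).mapL (K k)
  refine Summable.of_norm (summable_of_sum_le (c := ∑' n, ‖u n‖ * ‖v n‖)
    (fun k => norm_nonneg _) fun s => ?_)
  calc ∑ k ∈ s, ‖(block _ k k ρ).1‖ ≤ ∑ k ∈ s, ∑' n, ‖K k (u n)‖ * ‖K k (v n)‖ :=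
        Finset.sum_le_sum fun k _ => hle k
    _ = ∑' n, ∑ k ∈ s, ‖K k (u n)‖ * ‖K k (v n)‖ :=
        (Summable.tsum_finsetSum fun k _ => hk k).symm
    _ ≤ ∑' n, ‖u n‖ * ‖v n‖ :=
        (summable_sum fun k _ => hk k).tsum_le_tsum (hsum s) hs

theorem ptrace_add (V : Set Q) (ρ σ : TC Q) : ptrace V (ρ + σ) = ptrace V ρ + ptrace V σ := by
  rw [ptrace, ptrace, ptrace, ← (summable_block V ρ).tsum_add (summable_block V σ)]
  refine tsum_congr fun k => ?_
  simp [block]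

/-- The reduced state on `V` after a super-operator, as an additive map. -/
def reduced (V : Set Q) (ρ : TC Q) : CP Q →+ (Hilb V →L[ℂ] Hilb V) where
  toFun A := ptrace V (A.1 ρ)
  map_zero' := by simp [ptrace, block]
  map_add' A B := by simp [ptrace_add]

/-- Antisymmetry of the Löwner order. It turns `≂` into equality of values of additive maps, to
which finite sums can be applied. -/
theorem eqOn_iff (V : Set Q) (A B : CP Q) :
    EqOn V A B ↔ ∀ ρ, IsDensity ρ → reduced V ρ A = reduced V ρ B := by
  constructor
  · intro h ρ hρ
    exact le_antisymm (ContinuousLinearMap.le_def _ _ |>.2 (h.1 ρ hρ))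
      (ContinuousLinearMap.le_def _ _ |>.2 (h.2 ρ hρ))
  · intro h
    exact ⟨fun ρ hρ => (ContinuousLinearMap.le_def _ _).1 (h ρ hρ).le,
      fun ρ hρ => (ContinuousLinearMap.le_def _ _).1 (h ρ hρ).ge⟩

theorem EqOn.refl (V : Set Q) (A : CP Q) : EqOn V A A := (eqOn_iff _ _ _).2 fun _ _ => rfl

theorem EqOn.trans {V : Set Q} {A B C : CP Q} (h : EqOn V A B) (h' : EqOn V B C) : EqOn V A C :=
  (eqOn_iff _ _ _).2 fun ρ hρ => ((eqOn_iff _ _ _).1 h ρ hρ).trans ((eqOn_iff _ _ _).1 h' ρ hρ)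

theorem EqOn.of_set_eq {V W : Set Q} {A B : CP Q} (h : EqOn V A B) (e : W = V) : EqOn W A B :=
  e ▸ h

end PartialTrace

/-! ### Weights on equivalence classes and the lifting of relations -/

section Lifting

section Weights

variable {X X' N M : Type*} [AddCommMonoid N] [AddCommMonoid M]

/-- The sum of the values of `f` on `T`. -/
def weight (f : X →₀ N) (T : Set X) : N :=
  open Classical in (f.filter (· ∈ T)).sum fun _ a => a

open Classical in
theorem map_weight (φ : N →+ M) (f : X →₀ N) (T : Set X) :
    φ (weight f T) = f.sum fun s a => if s ∈ T then φ a else 0 := by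
  rw [weight, Finsupp.sum_filter_index, map_sum, Finsupp.support_filter, Finset.sum_filter]
  rfl

theorem weight_mapDomain (g : X → X') (f : X →₀ N) (T : Set X') :
    weight (f.mapDomain g) T = weight f (g ⁻¹' T) := by
  classical
  have h := map_weight (AddMonoidHom.id N) (f.mapDomain g) T
  have h' := map_weight (AddMonoidHom.id N) f (g ⁻¹' T)
  simp only [AddMonoidHom.id_apply] at h h'
  rw [h, h', Finsupp.sum_mapDomain_index (by simp) (by intros; split_ifs <;> simp)]
  rfl

/-- If two finitely supported functions have equal sums over the classes of an equivalence relation,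
then they have equal sums over the classes of a coarser one. -/
theorem weight_eq_of_coarser (φ : N →+ M) {R R' : X → X → Prop} (hR : Equivalence R)
    (hR' : Equivalence R') (hle : ∀ s s', R s s' → R' s s') {f g : X →₀ N}
    (h : ∀ s, φ (weight f {s' | R s s'}) = φ (weight g {s' | R s s'})) (s : X) :
    φ (weight f {s' | R' s s'}) = φ (weight g {s' | R' s s'}) := by
  classical
  -- After applying `φ`, both functions are pushed to the quotient by `R`. The hypothesis compares
  -- them there point by point, so the pushed functions are equal.
  let q : X → Quotient ⟨R, hR⟩ := Quotient.mk _
  have push : ∀ (f : X →₀ N) (T : Set (Quotient ⟨R, hR⟩)),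
      φ (weight f (q ⁻¹' T)) = ((f.mapRange φ (map_zero _)).mapDomain q).sum
        fun c a => if c ∈ T then a else 0 := by
    intro f T
    rw [map_weight, Finsupp.sum_mapDomain_index (by simp) (by intros; split_ifs <;> simp),
      Finsupp.sum_mapRange_index (by simp)]
    rfl
  have hq : (f.mapRange φ (map_zero _)).mapDomain q
      = (g.mapRange φ (map_zero _)).mapDomain q := by
    ext1 c
    obtain ⟨r, rfl⟩ := Quotient.exists_rep c
    have hcls : {s' | R r s'} = q ⁻¹' {q r} := by
      ext s'
      exact ⟨fun hs => Quotient.sound (hR.symm hs), fun hs => hR.symm (Quotient.exact hs)⟩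
    have := h r
    rw [hcls, push, push] at this
    simpa only [Set.mem_singleton_iff, Finsupp.sum_ite_self_eq'] using this
  -- A class of the coarser relation is saturated for `R`, so its weight can be read off in the
  -- quotient.
  have hsat : {s' | R' s s'} = q ⁻¹' (q '' {s' | R' s s'}) := by
    ext s'
    refine ⟨fun hs => ⟨s', hs, rfl⟩, ?_⟩
    rintro ⟨r, hr, hrs⟩
    exact hR'.trans hr (hle _ _ (Quotient.exact hrs))
  rw [hsat, push, push, hq]

theorem mapDomain_mapDomain_eq {Y Y' : Type*} (f : X → Y) (g : Y → X') (f' : X → Y')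
    (g' : Y' → X')
    (h : ∀ x, g (f x) = g' (f' x)) (v : X →₀ N) :
    (v.mapDomain f).mapDomain g = (v.mapDomain f').mapDomain g' := by
  rw [← Finsupp.mapDomain_comp, ← Finsupp.mapDomain_comp]
  exact congrArg (Finsupp.mapDomain · v) (funext h)

theorem mapDomain_mapDomain_eq_self {f : X → X'} {g : X' → X} (h : ∀ x, g (f x) = x)
    (v : X →₀ N) : (v.mapDomain f).mapDomain g = v := by
  rw [← Finsupp.mapDomain_comp, show g ∘ f = id from funext h, Finsupp.mapDomain_id]

theorem mapDomain_sum_single {ι : Type*} [Fintype ι] (f : X → X') {x : ι → X} {x' : ι → X'}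
    (h : ∀ i, f (x i) = x' i) (a : ι → N) :
    (∑ i, Finsupp.single (x i) (a i)).mapDomain f = ∑ i, Finsupp.single (x' i) (a i) := by
  simp only [Finsupp.mapDomain_finsetSum, Finsupp.mapDomain_single, h]

end Weights

variable {Q : Type} {X X' : Type 1}

/-- The image of a distribution under a map of states. -/
def pushforward (f : X → X') (Δ : SVal Q X) : SVal Q X' := Δ.mapDomain f

theorem pushforward_single (f : X → X') (x : X) (A : CP Q) :
    pushforward f (Finsupp.single x A) = Finsupp.single (f x) A :=
  Finsupp.mapDomain_single

theorem pushforward_sum_single {ι : Type} [Fintype ι] (f : X → X') {x : ι → X} {x' : ι → X'}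
    (h : ∀ i, f (x i) = x' i) (A : ι → CP Q) :
    pushforward f (∑ i, Finsupp.single (x i) (A i)) = ∑ i, Finsupp.single (x' i) (A i) :=
  mapDomain_sum_single f h A

theorem pushforward_pushforward_eq {Y Y' : Type 1} {f : X → Y} {g : Y → X'} {f' : X → Y'}
    {g' : Y' → X'} (h : ∀ x, g (f x) = g' (f' x)) (Δ : SVal Q X) :
    pushforward g (pushforward f Δ) = pushforward g' (pushforward f' Δ) :=
  mapDomain_mapDomain_eq f g f' g' h Δ

theorem pushforward_pushforward_eq_self {f : X → X'} {g : X' → X} (h : ∀ x, g (f x) = x)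
    (Δ : SVal Q X) : pushforward g (pushforward f Δ) = Δ :=
  mapDomain_mapDomain_eq_self h Δ

theorem IsDist.pushforward {Δ : SVal Q X} (h : IsDist Δ) (f : X → X') :
    IsDist (pushforward f Δ) := by
  have e : ((QCCS.pushforward f Δ).sum fun _ A => A) = Δ.sum fun _ A => A :=
    Finsupp.sum_mapDomain_index (fun _ => rfl) fun _ _ _ => rfl
  rwa [IsDist, e]

/-- Two distributions with the same weights on the classes of an equivalence relation have the
same weights on the classes of a coarser one. -/
theorem Lift.mono {R R' : X → X → Prop} (hR : Equivalence R) (hR' : Equivalence R')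
    (hle : ∀ s s', R s s' → R' s s') {Δ Ξ : SVal Q X} (h : Lift R Δ Ξ) : Lift R' Δ Ξ :=
  fun s => (eqOn_iff _ _ _).2 fun ρ hρ =>
    weight_eq_of_coarser (reduced ∅ ρ) hR hR' hle
      (fun s => (eqOn_iff _ _ _).1 (h s) ρ hρ) s

theorem Lift.refl (R : X → X → Prop) (Δ : SVal Q X) : Lift R Δ Δ := fun _ => EqOn.refl _ _

theorem Lift.trans {R : X → X → Prop} {Δ Ξ Θ : SVal Q X} (h : Lift R Δ Ξ) (h' : Lift R Ξ Θ) :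
    Lift R Δ Θ := fun s => (h s).trans (h' s)

theorem Lift.of_eq {R : X → X → Prop} {Δ Δ' Ξ Ξ' : SVal Q X} (h : Lift R Δ Ξ) (e : Δ' = Δ)
    (e' : Ξ' = Ξ) : Lift R Δ' Ξ' :=
  e ▸ e' ▸ h

theorem mass_pushforward (f : X → X') (Δ : SVal Q X) (T : Set X') :
    mass (pushforward f Δ) T = mass Δ (f ⁻¹' T) :=
  weight_mapDomain f Δ T

/-- The bijection pulls classes of `R'` back to classes of `R`, so the weights to be compared are
the same. -/
theorem Lift.pushforward {R : X → X → Prop} {R' : X' → X' → Prop} (f : X ≃ X')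
    (hR : ∀ s s', R' (f s) s' ↔ R s (f.symm s')) {Δ Ξ : SVal Q X} (h : Lift R Δ Ξ) :
    Lift R' (pushforward f Δ) (pushforward f Ξ) := by
  intro s
  obtain ⟨s, rfl⟩ := f.surjective s
  have e : f ⁻¹' {s' | R' (f s) s'} = {s' | R s s'} := by ext; simp [hR]
  rw [mass_pushforward, mass_pushforward, e]
  exact h s

theorem combine_pushforward (E : CP Q) (f : X → X') (Δ : SVal Q X) :
    combine E (pushforward f Δ) = pushforward f (combine E Δ) :=
  (Finsupp.mapDomain_mapRange f Δ _ _ fun x y => add_mul x y E).symm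

end Lifting

/-! ## Equivariance of the symbolic semantics -/

namespace Act

/-- Renaming of the classical variables of an action. -/
def rename (π : S.cVar → S.cVar) : Act S → Act S
  | tau => tau
  | cin c x => cin c (π x)
  | cout c e => cout c (FirstOrder.Language.Term.subst e fun x => .var (π x))
  | qin c r => qin c r
  | qout c r => qout c r

theorem bv_rename (π : S.cVar → S.cVar) (γ : Act S) : (γ.rename π).bv = π '' γ.bv := by
  cases γ <;> simp [rename, bv]

theorem qbv_rename (π : S.cVar → S.cVar) (γ : Act S) : (γ.rename π).qbv = γ.qbv := by
  cases γ <;> rfl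

theorem cn_rename (π : S.cVar → S.cVar) (γ : Act S) : (γ.rename π).cn = γ.cn := by
  cases γ <;> rfl

theorem rename_relabel (π : S.cVar → S.cVar) (f : Relabelling S) (γ : Act S) :
    (γ.relabel f).rename π = (γ.rename π).relabel f := by
  cases γ <;> rfl

theorem rename_symm_rename (π : Equiv.Perm S.cVar) (γ : Act S) :
    (γ.rename π).rename π.symm = γ := by
  cases γ with
  | cout c e =>
    simp only [rename, term_subst_subst, cout.injEq, true_and]
    exact Exp.subst_eq_self e _ fun x _ => by simp [FirstOrder.Language.Term.subst]
  | _ => simp [rename]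

/-- Lets the side condition on the bound variable pass from one link of a chain to the next. -/
theorem EqUnder.bv_eq {b : BExp S S.cVar} {γ γ' : Act S} (h : EqUnder b γ γ') :
    γ'.bv = γ.bv := by
  cases γ with
  | cout => obtain ⟨e', rfl, -⟩ := h; rfl
  | _ => rw [← show _ = γ' from h]

theorem EqUnder.refl (b : BExp S S.cVar) (γ : Act S) : EqUnder b γ γ := by
  cases γ with
  | cout c e => exact ⟨e, rfl, fun _ _ => rfl⟩
  | _ => rfl

theorem EqUnder.weaken {b c : BExp S S.cVar} (hbc : c.Entails b) {γ γ' : Act S}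
    (h : EqUnder b γ γ') : EqUnder c γ γ' := by
  cases γ with
  | cout => obtain ⟨e', rfl, he⟩ := h; exact ⟨e', rfl, fun ψ hψ => he ψ (hbc ψ hψ)⟩
  | _ => exact h

theorem EqUnder.trans {b : BExp S S.cVar} {γ γ' γ'' : Act S} (h : EqUnder b γ γ')
    (h' : EqUnder b γ' γ'') : EqUnder b γ γ'' := by
  cases γ with
  | cout =>
    obtain ⟨e', rfl, he⟩ := h
    obtain ⟨e'', rfl, he'⟩ := h'
    exact ⟨e'', rfl, fun ψ hψ => Eq.trans (he ψ hψ) (he' ψ hψ)⟩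
  | _ =>
    rw [← show _ = γ' from h] at h'
    exact h'

theorem EqUnder.rename {b : BExp S S.cVar} {γ γ' : Act S} (h : EqUnder b γ γ')
    (π : S.cVar → S.cVar) : EqUnder (b.rename π) (γ.rename π) (γ'.rename π) := by
  cases γ with
  | cout c e =>
    obtain ⟨e', rfl, he⟩ := h
    exact ⟨_, rfl, BExp.Entails.rename he π⟩
  | _ =>
    rw [← show _ = γ' from h]
    exact EqUnder.refl _ _

end Act

/-- Renaming of the classical variables of a pre-snapshot. -/
def Pre.rename (π : S.cVar → S.cVar) (s : Pre S) : Pre S := (s.1.rename π, s.2)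

theorem pushforward_rename_point (π : S.cVar → S.cVar) (t : Proc S S.cVar S.qVar)
    (E : CPt S.qVar) :
    pushforward (Pre.rename π) (point (t, E)) = point (t.rename π, E) :=
  pushforward_single _ _ _

theorem pushforward_mapProc (π : S.cVar → S.cVar)
    (F F' : Proc S S.cVar S.qVar → Proc S S.cVar S.qVar)
    (hF : ∀ t, (F t).rename π = F' (t.rename π)) (Δ : SVal S.qVar (Pre S)) :
    pushforward (Pre.rename π) (mapProc F Δ) = mapProc F' (pushforward (Pre.rename π) Δ) :=
  pushforward_pushforward_eq (f := fun s : Pre S => ((F s.1, s.2) : Pre S)) (g := Pre.rename π)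
    (f' := Pre.rename π)
    (g' := fun s : Pre S => ((F' s.1, s.2) : Pre S)) (fun s => Prod.ext (hF s.1) rfl) Δ

theorem Trans.of_eq {D : DefEqs S} {s : Pre S} {b : BExp S S.cVar} {γ : Act S}
    {Δ Δ' : SVal S.qVar (Pre S)} (h : Trans D s b γ Δ) (e : Δ' = Δ) : Trans D s b γ Δ' :=
  e ▸ h

theorem Trans.of_proc_eq {D : DefEqs S} {t t' : Proc S S.cVar S.qVar} {E : CPt S.qVar}
    {b : BExp S S.cVar} {γ : Act S} {Δ : SVal S.qVar (Pre S)} (h : Trans D (t, E) b γ Δ)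
    (e : t' = t) : Trans D (t', E) b γ Δ :=
  e ▸ h

theorem Trans.of_act_eq {D : DefEqs S} {s : Pre S} {b : BExp S S.cVar} {γ γ' : Act S}
    {Δ : SVal S.qVar (Pre S)} (h : Trans D s b γ Δ) (e : γ' = γ) : Trans D s b γ' Δ :=
  e ▸ h

theorem Exp.rename_const {X X' : Type} (σ : X → Exp S X') (r : ℝ) :
    FirstOrder.Language.Term.subst (Exp.const (S := S) r) σ = Exp.const r :=
  congrArg (FirstOrder.Language.Term.func _) (funext fun i => Fin.elim0 i)

theorem Proc.disjoint_bv_rename (π : Equiv.Perm S.cVar) {γ : Act S}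
    {u : Proc S S.cVar S.qVar} (h : Disjoint γ.bv u.fv) :
    Disjoint (γ.rename π).bv (u.rename π).fv := by
  rw [Act.bv_rename, Proc.fv_rename]
  exact (Set.disjoint_image_iff π.injective).2 h

theorem Proc.disjoint_qbv_rename (π : S.cVar → S.cVar) {γ : Act S}
    {u : Proc S S.cVar S.qVar} (h : Disjoint γ.qbv u.qv) :
    Disjoint (γ.rename π).qbv (u.rename π).qv := by
  rwa [Act.qbv_rename, Proc.qv_rename]

theorem pushforward_rename_outcomes {ι : Type} [Fintype ι] (π : S.cVar → S.cVar)
    (t : Proc S (Option S.cVar) S.qVar) (lam : ι → ℝ) (R : ι → CPt S.qVar) (A : ι → CP S.qVar) :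
    pushforward (Pre.rename π) (∑ i, Finsupp.single (t.openC (Exp.const (lam i)), R i) (A i))
      = ∑ i, Finsupp.single
        ((t.subst (Proc.up fun x => .var (π x)) id).openC (Exp.const (lam i)), R i) (A i) := by
  have h : ∀ i, Pre.rename π (t.openC (Exp.const (lam i)), R i)
      = ((t.subst (Proc.up fun x => .var (π x)) id).openC (Exp.const (lam i)), R i) := fun i =>
    Prod.ext ((Proc.rename_openC π t _).trans (congrArg _ (Exp.rename_const _ _))) rfl
  exact pushforward_sum_single (Pre.rename π) h A

/-- The symbolic semantics is equivariant under permutations of the classical variables. -/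
theorem Trans.rename {D : DefEqs S} {s : Pre S} {b : BExp S S.cVar} {γ : Act S}
    {Δ : SVal S.qVar (Pre S)} (h : Trans D s b γ Δ) (π : Equiv.Perm S.cVar) :
    Trans D (s.rename π) (b.rename π) (γ.rename π) (pushforward (Pre.rename π) Δ) := by
  induction h with
  | tau t E => exact (Trans.tau _ _).of_eq (pushforward_rename_point _ _ _)
  | cin c t E x hx =>
    refine (Trans.cin c _ E (π x) fun h => hx ?_).of_eq
      ((pushforward_rename_point _ _ _).trans (congrArg (fun t => point (t, E))
        (Proc.rename_openC π t _)))
    have h' : π x ∈ ((t.cin c).rename π).fv := h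
    rw [Proc.fv_rename] at h'
    exact (π.injective.mem_set_image).1 h'
  | cout c e t E => exact (Trans.cout _ _ _ _).of_eq (pushforward_rename_point _ _ _)
  | qin c t E r hr =>
    exact (Trans.qin c _ E r fun h => hr (Proc.qv_rename π (t.qin c) ▸ h)).of_eq
      ((pushforward_rename_point _ _ _).trans (congrArg (fun t => point (t, E))
        (Proc.rename_openQ π t r)))
  | qout c q t E => exact (Trans.qout _ _ _ _).of_eq (pushforward_rename_point _ _ _)
  | oper F q t E F' hF => exact (Trans.oper F q _ E F' hF).of_eq (pushforward_rename_point _ _ _)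
  | meas M q t E φ lam hM A R hA hR =>
    -- The eigenvalues substituted for the bound variable are closed expressions, so only the body
    -- of the measurement is renamed.
    exact (Trans.meas M q (t.subst (Proc.up fun x => .var (π x)) id) E φ lam hM A R hA hR).of_eq
      (pushforward_rename_outcomes π t lam (fun i => R i * E) A)
  | sumL h ih => exact .sumL ih
  | sumR h ih => exact .sumR ih
  | @parL t u E b γ Δ h hc hq ih =>
    exact (Trans.parL ih (Proc.disjoint_bv_rename π hc) (Proc.disjoint_qbv_rename π hq)).of_eq
      (pushforward_mapProc π (·.par u) (·.par (u.rename π)) (fun _ => rfl) Δ)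
  | @parR t u E b γ Δ h hc hq ih =>
    exact (Trans.parR ih (Proc.disjoint_bv_rename π hc) (Proc.disjoint_qbv_rename π hq)).of_eq
      (pushforward_mapProc π (t.par ·) ((t.rename π).par ·) (fun _ => rfl) Δ)
  | @ccomL t u t' u' E b₁ b₂ c x e h₁ h₂ ih₁ ih₂ =>
    exact (Trans.ccomL (ih₁.of_eq (pushforward_rename_point _ _ _).symm)
      (ih₂.of_eq (pushforward_rename_point _ _ _).symm)).of_eq
      ((pushforward_rename_point _ _ _).trans (congrArg (fun v => point (v.par (u'.rename π), E))
        (Proc.rename_substVar π t' e x)))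
  | @ccomR t u t' u' E b₁ b₂ c x e h₁ h₂ ih₁ ih₂ =>
    exact (Trans.ccomR (ih₁.of_eq (pushforward_rename_point _ _ _).symm)
      (ih₂.of_eq (pushforward_rename_point _ _ _).symm)).of_eq
      ((pushforward_rename_point _ _ _).trans (congrArg (fun v => point ((t'.rename π).par v, E))
        (Proc.rename_substVar π u' e x)))
  | qcomL h₁ h₂ ih₁ ih₂ =>
    exact (Trans.qcomL (ih₁.of_eq (pushforward_rename_point _ _ _).symm)
      (ih₂.of_eq (pushforward_rename_point _ _ _).symm)).of_eq (pushforward_rename_point _ _ _)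
  | qcomR h₁ h₂ ih₁ ih₂ =>
    exact (Trans.qcomR (ih₁.of_eq (pushforward_rename_point _ _ _).symm)
      (ih₂.of_eq (pushforward_rename_point _ _ _).symm)).of_eq (pushforward_rename_point _ _ _)
  | @res t E b γ Δ L h hL ih =>
    exact (Trans.res ih (by rwa [Act.cn_rename])).of_eq
      (pushforward_mapProc π (·.res L) (·.res L) (fun _ => rfl) Δ)
  | @rel t E b γ Δ f h ih =>
    have h := (Trans.rel (f := f) ih).of_eq
      (pushforward_mapProc π (·.rel f) (·.rel f) (fun _ => rfl) Δ)
    exact h.of_act_eq (Act.rename_relabel π f γ)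
  | ite h ih => exact .ite ih
  | @con A e q E b γ Δ h ih =>
    -- The body of a constant contains only its formal parameters, so renaming the unfolded constant
    -- amounts to renaming the arguments.
    have h' := Proc.subst_subst (D.body A) e q (fun x => .var (π x)) id
    exact .con (ih.of_proc_eq h'.symm)

/-- Permutation of the classical variables of a snapshot. -/
def Snap.rename (π : Equiv.Perm S.cVar) : Snap S ≃ Snap S where
  toFun s := (⟨s.1.1.rename π, s.1.2.rename π⟩, s.2)
  invFun s := (⟨s.1.1.rename π.symm, s.1.2.rename π.symm⟩, s.2)
  left_inv _ := Prod.ext (Subtype.ext (Proc.rename_symm_rename π _)) rfl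
  right_inv _ := Prod.ext (Subtype.ext (Proc.rename_symm_rename π.symm _)) rfl

theorem Snap.rename_eq_self (π : Equiv.Perm S.cVar) (s : Snap S) (h : ∀ x ∈ s.1.1.fv, π x = x) :
    Snap.rename π s = s :=
  Prod.ext (Subtype.ext (Proc.rename_eq_self π _ h)) rfl

theorem Step.rename {D : DefEqs S} {s : Snap S} {b : BExp S S.cVar} {γ : Act S}
    {Δ : SVal S.qVar (Snap S)} (h : Step D s b γ Δ) (π : Equiv.Perm S.cVar) :
    Step D (Snap.rename π s) (b.rename π) (γ.rename π) (pushforward (Snap.rename π) Δ) := by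
  refine ⟨h.1.pushforward _, ?_⟩
  exact (h.2.rename π).of_eq (pushforward_pushforward_eq
    (g := fun s : Snap S => ((s.1.1, s.2) : Pre S)) (g' := Pre.rename π) (fun _ => rfl) Δ)

/-! ## Chains of symbolic bisimulations -/

variable {D : DefEqs S}

/-- Equal free quantum variables, and equal reduced states on the qubits that are not owned. -/
def Agree (s s' : Snap S) : Prop := s.1.1.qv = s'.1.1.qv ∧ EqOn (s.1.1.qv)ᶜ s.2.1 s'.2.1

/-- The snapshot obtained by performing `G` first. -/
def Snap.perform (G : CPt S.qVar) (s : Snap S) : Snap S := (s.1, G * s.2)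

/-- Some transition of `s'` matches, under `b'`, the transition of `s` by `γ` to `Δ`. -/
def Matches (D : DefEqs S) (R : BExp S S.cVar → Snap S → Snap S → Prop) (b' : BExp S S.cVar)
    (s s' : Snap S) (γ : Act S) (Δ : SVal S.qVar (Snap S)) : Prop :=
  ∃ (b₂ : BExp S S.cVar) (γ' : Act S) (Ξ : SVal S.qVar (Snap S)),
    b'.Entails b₂ ∧ Act.EqUnder b' γ γ' ∧ Step D s' b₂ γ' Ξ ∧
    Lift (R b') (combine s.2.1 Δ) (combine s'.2.1 Ξ)

/-- Every transition of `s`, after a super-operator on the qubits that `s` does not own, is matched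
under `b` by transitions of `s'`, provided that its bound variable is not in `X`. -/
def Simulates (D : DefEqs S) (R : BExp S S.cVar → Snap S → Snap S → Prop) (b : BExp S S.cVar)
    (X : Set S.cVar) (s s' : Snap S) : Prop :=
  ∀ G : CPt S.qVar, ActsOn (s.1.1.qv)ᶜ G →
    ∀ (b₁ : BExp S S.cVar) (γ : Act S) (Δ : SVal S.qVar (Snap S)),
      Step D (s.perform G) b₁ γ Δ → Disjoint γ.bv X →
      ∀ ψ : S.cVar → ℝ, b.eval ψ → b₁.eval ψ →
      ∃ b' : BExp S S.cVar, b'.eval ψ ∧ Matches D R b' (s.perform G) (s'.perform G) γ Δ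

theorem IsSymbolicBisimulation.agree {R : BExp S S.cVar → Snap S → Snap S → Prop}
    (h : IsSymbolicBisimulation D R) {b : BExp S S.cVar} {s s' : Snap S} (hs : R b s s')
    (hb : b.Satisfiable) : Agree s s' :=
  (h.2 b s.1 s'.1 s.2 s'.2 hs).1 hb

theorem IsSymbolicBisimulation.simulates {R : BExp S S.cVar → Snap S → Snap S → Prop}
    (h : IsSymbolicBisimulation D R) {b : BExp S S.cVar} {s s' : Snap S} (hs : R b s s') :
    Simulates D R b (b.fv ∪ s.1.1.fv ∪ s'.1.1.fv) s s' := by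
  intro G hG b₁ γ Δ hst hd ψ hb hb₁
  obtain ⟨B, hB, hm⟩ := (h.2 b s.1 s'.1 s.2 s'.2 hs).2 G hG b₁ γ Δ hst hd
  obtain ⟨b', hb', he⟩ := hB ψ ⟨hb, hb₁⟩
  exact ⟨b', he, hm b' hb'⟩

/-- The definition allows an arbitrary collection `B`, so it suffices to match each evaluation `ψ`
separately and to take for `B` all conditions under which a match exists. -/
theorem isSymbolicBisimulation_of_simulates {R : BExp S S.cVar → Snap S → Snap S → Prop}
    (h : ∀ b, Equivalence (R b)) (ha : ∀ b s s', R b s s' → b.Satisfiable → Agree s s')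
    (hs : ∀ b s s', R b s s' → Simulates D R b (b.fv ∪ s.1.1.fv ∪ s'.1.1.fv) s s') :
    IsSymbolicBisimulation D R :=
  ⟨h, fun b t u E F hR => ⟨ha b (t, E) (u, F) hR, fun G hG b₁ γ Δ hst hd =>
    ⟨{b' | Matches D R b' (t, G * E) (u, G * F) γ Δ},
      fun ψ hψ => (hs b (t, E) (u, F) hR G hG b₁ γ Δ hst hd ψ hψ.1 hψ.2).imp fun _ => And.symm,
      fun _ => id⟩⟩⟩

/-! ### Transport of simulations along permutations of the classical variables -/

theorem Snap.rename_symm_rename (π : Equiv.Perm S.cVar) (s : Snap S) :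
    Snap.rename π.symm (Snap.rename π s) = s := (Snap.rename π).symm_apply_apply s

theorem Snap.rename_rename_symm (π : Equiv.Perm S.cVar) (s : Snap S) :
    Snap.rename π (Snap.rename π.symm s) = s := (Snap.rename π).apply_symm_apply s

theorem Snap.qv_rename (π : Equiv.Perm S.cVar) (s : Snap S) :
    (Snap.rename π s).1.1.qv = s.1.1.qv := Proc.qv_rename _ _

theorem Snap.fv_rename (π : Equiv.Perm S.cVar) (s : Snap S) :
    (Snap.rename π s).1.1.fv = π '' s.1.1.fv := Proc.fv_rename _ _

theorem Agree.of_rename {π : Equiv.Perm S.cVar} {s s' : Snap S}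
    (h : Agree (Snap.rename π s) (Snap.rename π s')) : Agree s s' :=
  ⟨(Snap.qv_rename π s).symm.trans (h.1.trans (Snap.qv_rename π s')),
    h.2.of_set_eq (congrArg _ (Snap.qv_rename π s).symm)⟩

/-- Undo a renaming in a match. -/
theorem Matches.of_rename {R R' : BExp S S.cVar → Snap S → Snap S → Prop}
    (π : Equiv.Perm S.cVar)
    (hR : ∀ b s s', R' b s s' ↔ R (b.rename π) (Snap.rename π s) (Snap.rename π s'))
    {b' : BExp S S.cVar} {s s' : Snap S} {γ : Act S} {Δ : SVal S.qVar (Snap S)}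
    (h : Matches D R b' (Snap.rename π s) (Snap.rename π s') (γ.rename π)
      (pushforward (Snap.rename π) Δ)) :
    Matches D R' (b'.rename π.symm) s s' γ Δ := by
  obtain ⟨b₂, γ', Ξ, he, hγ, hst, hl⟩ := h
  refine ⟨b₂.rename π.symm, γ'.rename π.symm, pushforward (Snap.rename π.symm) Ξ, he.rename _,
    ?_, ?_, ?_⟩
  · have := hγ.rename π.symm
    rwa [Act.rename_symm_rename] at this
  · have := hst.rename π.symm
    rwa [Snap.rename_symm_rename] at this
  · have hR' : ∀ r r', R' (b'.rename π.symm) (Snap.rename π.symm r) r'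
        ↔ R b' r ((Snap.rename π.symm).symm r') := fun r r' => by
      rw [hR, BExp.rename_rename_symm, Snap.rename_rename_symm]
      rfl
    refine (hl.pushforward (Snap.rename π.symm) hR').of_eq ?_ (combine_pushforward _ _ _)
    exact (congrArg _ (pushforward_pushforward_eq_self (Snap.rename_symm_rename π) Δ).symm).trans
      (combine_pushforward _ _ _)

/-- Undo a renaming in a simulation. -/
theorem Simulates.of_rename {R R' : BExp S S.cVar → Snap S → Snap S → Prop}
    (π : Equiv.Perm S.cVar)
    (hR : ∀ b s s', R' b s s' ↔ R (b.rename π) (Snap.rename π s) (Snap.rename π s'))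
    {b : BExp S S.cVar} {X : Set S.cVar} {s s' : Snap S}
    (h : Simulates D R (b.rename π) (π '' X) (Snap.rename π s) (Snap.rename π s')) :
    Simulates D R' b X s s' := by
  intro G hG b₁ γ Δ hst hd ψ hb hb₁
  -- The given simulation is used at the evaluation `ψ ∘ π⁻¹`, where a renamed condition has the
  -- truth value of the original one at `ψ`.
  have hev : ∀ c : BExp S S.cVar, (c.rename π).eval (ψ ∘ π.symm) ↔ c.eval ψ := fun c => by
    rw [BExp.eval_rename, Function.comp_assoc, Equiv.symm_comp_self, Function.comp_id]
  have hd' : Disjoint (γ.rename π).bv (π '' X) := by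
    rw [Act.bv_rename]
    exact (Set.disjoint_image_iff π.injective).2 hd
  have hG' : ActsOn ((Snap.rename π s).1.1.qv)ᶜ G := by rwa [Snap.qv_rename]
  obtain ⟨b', hb', hm⟩ := h G hG' (b₁.rename π) (γ.rename π) (pushforward (Snap.rename π) Δ)
    (hst.rename π) hd' (ψ ∘ π.symm) ((hev b).2 hb) ((hev b₁).2 hb₁)
  exact ⟨b'.rename π.symm, (BExp.eval_rename _ _ _).2 hb',
    Matches.of_rename (s := s.perform G) (s' := s'.perform G) π hR hm⟩

theorem IsSymbolicBisimulation.rename {R : BExp S S.cVar → Snap S → Snap S → Prop}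
    (h : IsSymbolicBisimulation D R) (π : Equiv.Perm S.cVar) :
    IsSymbolicBisimulation D
      fun b s s' => R (b.rename π) (Snap.rename π s) (Snap.rename π s') := by
  refine isSymbolicBisimulation_of_simulates (fun b => (h.1 (b.rename π)).comap (Snap.rename π))
    (fun b s s' hs => ?_) fun b s s' hs => .of_rename π (fun _ _ _ => Iff.rfl) ?_
  · rintro ⟨ψ, hψ⟩
    have hsat : (b.rename π).Satisfiable := ⟨ψ ∘ π.symm, by
      rwa [BExp.eval_rename, Function.comp_assoc, Equiv.symm_comp_self, Function.comp_id]⟩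
    exact (h.agree hs hsat).of_rename
  · have := h.simulates hs
    rwa [Snap.fv_rename, Snap.fv_rename, BExp.fv_rename, ← Set.image_union, ← Set.image_union]
      at this

/-- Snapshots connected by finitely many symbolic bisimulations, each of them at a condition which
`c` entails. -/
def Chain (D : DefEqs S) (c : BExp S S.cVar) : Snap S → Snap S → Prop :=
  Relation.ReflTransGen fun s s' => ∃ R b, IsSymbolicBisimulation D R ∧ c.Entails b ∧ R b s s'

theorem Chain.equivalence (c : BExp S S.cVar) : Equivalence (Chain D c) where
  refl _ := .refl
  symm h := by
    induction h with
    | refl => exact .refl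
    | tail _ h ih =>
      obtain ⟨R, b, hR, hb, h⟩ := h
      exact ih.head ⟨R, b, hR, hb, (hR.1 b).symm h⟩
  trans := Relation.ReflTransGen.trans

theorem Chain.of_bisimulation {R : BExp S S.cVar → Snap S → Snap S → Prop}
    (hR : IsSymbolicBisimulation D R) {b c : BExp S S.cVar} (hc : c.Entails b) {s s' : Snap S}
    (h : R b s s') : Chain D c s s' := .single ⟨R, b, hR, hc, h⟩

/-- The reason for letting links live at weaker conditions: a symbolic bisimulation need not be
monotone in its condition, whereas matches obtained under different conditions must be compared
under their conjunction. -/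
theorem Chain.weaken {b c : BExp S S.cVar} (hc : c.Entails b) {s s' : Snap S}
    (h : Chain D b s s') : Chain D c s s' := by
  induction h with
  | refl => exact .refl
  | tail _ h ih =>
    obtain ⟨R, a, hR, ha, h⟩ := h
    exact ih.tail ⟨R, a, hR, fun ψ hψ => ha ψ (hc ψ hψ), h⟩

/-- Each link is replaced by its transport along `π⁻¹`, which is again a bisimulation. -/
theorem Chain.rename {c : BExp S S.cVar} {s s' : Snap S} (h : Chain D c s s')
    (π : Equiv.Perm S.cVar) :
    Chain D (c.rename π) (Snap.rename π s) (Snap.rename π s') := by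
  induction h with
  | refl => exact .refl
  | tail _ h ih =>
    obtain ⟨R, b, hR, hb, h⟩ := h
    refine ih.tail ⟨_, b.rename π, hR.rename π.symm, hb.rename π, ?_⟩
    rwa [BExp.rename_symm_rename, Snap.rename_symm_rename, Snap.rename_symm_rename]

theorem Chain.rename_iff (π : Equiv.Perm S.cVar) (c : BExp S S.cVar) (s s' : Snap S) :
    Chain D c s s' ↔ Chain D (c.rename π) (Snap.rename π s) (Snap.rename π s') := by
  refine ⟨fun h => h.rename π, fun h => ?_⟩
  have := h.rename π.symm
  rwa [BExp.rename_symm_rename, Snap.rename_symm_rename, Snap.rename_symm_rename] at this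

theorem Agree.trans {s s' s'' : Snap S} (h : Agree s s') (h' : Agree s' s'') : Agree s s'' := by
  exact ⟨h.1.trans h'.1, h.2.trans (h'.2.of_set_eq (congrArg _ h.1))⟩

theorem Chain.agree {c : BExp S S.cVar} (hc : c.Satisfiable) {s s' : Snap S}
    (h : Chain D c s s') : Agree s s' := by
  induction h with
  | refl => exact ⟨rfl, EqOn.refl _ _⟩
  | tail _ h ih =>
    obtain ⟨R, b, hR, hb, h⟩ := h
    exact ih.trans (hR.agree h (hc.imp hb))

theorem Matches.trans {R : BExp S S.cVar → Snap S → Snap S → Prop}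
    (hR : IsSymbolicBisimulation D R) {b' b'' : BExp S S.cVar} {s s' s'' : Snap S}
    {γ γ' : Act S} {Δ Ξ : SVal S.qVar (Snap S)} (hγ : Act.EqUnder b' γ γ')
    (hl : Lift (Chain D b') (combine s.2.1 Δ) (combine s'.2.1 Ξ))
    (h : Matches D R b'' s' s'' γ' Ξ) : Matches D (Chain D) (b'.and b'') s s'' γ Δ := by
  obtain ⟨b₃, γ'', Θ, he, hγ', hst, hl'⟩ := h
  have w : (b'.and b'').Entails b' := fun _ h => h.1
  have w' : (b'.and b'').Entails b'' := fun _ h => h.2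
  exact ⟨b₃, γ'', Θ, fun ψ h => he ψ h.2, (hγ.weaken w).trans (hγ'.weaken w'), hst,
    (hl.mono (Chain.equivalence _) (Chain.equivalence _) fun _ _ => Chain.weaken w).trans
      (hl'.mono (hR.1 _) (Chain.equivalence _) fun _ _ => Chain.of_bisimulation hR w')⟩

/-- Matching along a chain, as long as the bound variables avoid a finite set. -/
theorem Chain.exists_simulates {c : BExp S S.cVar} (hc : c.Satisfiable) {s s' : Snap S}
    (h : Chain D c s s') : ∃ X : Set S.cVar, X.Finite ∧ Simulates D (Chain D) c X s s' := by
  induction h with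
  | refl =>
    exact ⟨∅, Set.finite_empty, fun G _ b₁ γ Δ hst _ ψ _ hb₁ =>
      -- On the empty chain a transition answers itself, under its own guard.
      ⟨b₁, hb₁, b₁, γ, Δ, fun _ => id, Act.EqUnder.refl _ _, hst, Lift.refl _ _⟩⟩
  | @tail s₁ s₂ h₁ h ih =>
    obtain ⟨X, hX, ih⟩ := ih
    obtain ⟨R, b, hR, hb, h⟩ := h
    -- Each link adds the variables that its own side condition forbids.
    refine ⟨X ∪ (b.fv ∪ s₁.1.1.fv ∪ s₂.1.1.fv), hX.union ((b.finite_fv.union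
      s₁.1.1.finite_fv).union s₂.1.1.finite_fv), fun G hG b₁ γ Δ hst hd ψ hψ hb₁ => ?_⟩
    rw [Set.disjoint_union_right] at hd
    obtain ⟨b', hb', b₂, γ', Ξ, he, hγ, hst', hl⟩ := ih G hG b₁ γ Δ hst hd.1 ψ hψ hb₁
    -- The intermediate snapshot owns the same qubits as the first one; this is where satisfiability
    -- of `c` enters.
    have hG' : ActsOn (s₁.1.1.qv)ᶜ G := by rwa [← (Chain.agree hc h₁).1]
    have hd' : Disjoint γ'.bv (b.fv ∪ s₁.1.1.fv ∪ s₂.1.1.fv) := by rw [hγ.bv_eq]; exact hd.2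
    obtain ⟨b'', hb'', hm⟩ :=
      hR.simulates h G hG' b₂ γ' Ξ hst' hd' ψ (hb ψ hψ) (he ψ hb')
    exact ⟨b'.and b'', ⟨hb', hb''⟩, hm.trans hR hγ hl⟩

/-- The bound variables of an action can be moved away from a finite set by a permutation. -/
theorem Act.exists_perm_disjoint (γ : Act S) {X Y : Set S.cVar} (hX : X.Finite) (hY : Y.Finite)
    (h : Disjoint γ.bv Y) :
    ∃ π : Equiv.Perm S.cVar, (∀ x ∈ Y, π x = x) ∧ Disjoint (π '' γ.bv) X := by
  classical
  by_cases hγ : ∃ x, γ.bv = {x}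
  · obtain ⟨x, hx⟩ := hγ
    rw [hx, Set.disjoint_singleton_left] at h
    -- A fresh variable `z` exists because `cVar` is infinite. The swap of `x` and `z` fixes `Y`,
    -- which contains neither.
    obtain ⟨z, hz⟩ := (hX.union hY).exists_notMem
    refine ⟨Equiv.swap x z, fun y hy => Equiv.swap_apply_of_ne_of_ne ?_ ?_, ?_⟩
    · rintro rfl
      exact h hy
    · rintro rfl
      exact hz (.inr hy)
    · rw [hx, Set.image_singleton, Equiv.swap_apply_left, Set.disjoint_singleton_left]
      exact fun hzX => hz (.inl hzX)
  · have : γ.bv = ∅ := by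
      cases γ with
      | cin c x => exact absurd ⟨x, rfl⟩ hγ
      | _ => rfl
    exact ⟨Equiv.refl _, fun _ _ => rfl, by simp [this]⟩

/-- By renaming the bound variable of an input it may be assumed to avoid any finite set. -/
theorem Simulates.of_finite {R : BExp S S.cVar → Snap S → Snap S → Prop}
    (hR : ∀ (π : Equiv.Perm S.cVar) b s s',
      R b s s' ↔ R (b.rename π) (Snap.rename π s) (Snap.rename π s'))
    {c : BExp S S.cVar} {X : Set S.cVar} (hX : X.Finite) {s s' : Snap S}
    (h : Simulates D R c X s s') :
    Simulates D R c (c.fv ∪ s.1.1.fv ∪ s'.1.1.fv) s s' := by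
  intro G hG b₁ γ Δ hst hd ψ hψ hb₁
  obtain ⟨π, hπ, hπγ⟩ := γ.exists_perm_disjoint hX
    ((c.finite_fv.union s.1.1.finite_fv).union s'.1.1.finite_fv) hd
  have hc := c.rename_eq_self π fun x hx => hπ x (.inl (.inl hx))
  have hs := Snap.rename_eq_self π s fun x hx => hπ x (.inl (.inr hx))
  have hs' := Snap.rename_eq_self π s' fun x hx => hπ x (.inr hx)
  -- Since `π` fixes `c`, `s` and `s'`, undoing the renaming gives the same simulation with
  -- forbidden set `π⁻¹ X`, which the bound variable of `γ` avoids by the choice of `π`.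
  have hsim : Simulates D R c (π.symm '' X) s s' := by
    refine .of_rename π (hR π) ?_
    rwa [hc, hs, hs', ← Set.image_comp, Equiv.self_comp_symm, Set.image_id]
  refine hsim G hG b₁ γ Δ hst ?_ ψ hψ hb₁
  rw [← Set.disjoint_image_iff π.injective, ← Set.image_comp, Equiv.self_comp_symm, Set.image_id]
  exact hπγ

/-- For satisfiable `c` this is matching along the chain followed by the freshness argument.
Otherwise the links need not agree on the owned qubits, but no evaluation remains to be matched. -/
theorem Chain.isSymbolicBisimulation : IsSymbolicBisimulation D (Chain D) := by
  refine isSymbolicBisimulation_of_simulates Chain.equivalence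
    (fun c s s' h hc => Chain.agree hc h) fun c s s' h => ?_
  by_cases hc : c.Satisfiable
  · obtain ⟨X, hX, hsim⟩ := h.exists_simulates hc
    exact hsim.of_finite Chain.rename_iff hX
  · exact fun G _ b₁ γ Δ _ _ ψ hψ => absurd ⟨ψ, hψ⟩ hc

/-- A bisimilar pair is a chain with one link; conversely, the family of chains is itself the
witnessing bisimulation. -/
theorem bisimilar_eq_chain : Bisimilar D = Chain D := by
  funext b s s'
  refine propext ⟨?_, fun h => ⟨_, Chain.isSymbolicBisimulation, h⟩⟩
  rintro ⟨R, hR, h⟩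
  exact Chain.of_bisimulation hR (fun _ => id) h

end QCCS

end

/-- Each symbolic `b`-bisimilarity is an equivalence relation, and the family of all of them is a
symbolic bisimulation, the largest one. -/
theorem mainTheorem3 (S : QCCS.Signature) (D : QCCS.DefEqs S) :
    (∀ b : QCCS.BExp S S.cVar, Equivalence (QCCS.Bisimilar D b)) ∧
    QCCS.IsSymbolicBisimulation D (QCCS.Bisimilar D) ∧
    (∀ R : QCCS.BExp S S.cVar → QCCS.Snap S → QCCS.Snap S → Prop,
      QCCS.IsSymbolicBisimulation D R →
      ∀ (b : QCCS.BExp S S.cVar) (s s' : QCCS.Snap S), R b s s' → QCCS.Bisimilar D b s s') := by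
  refine ⟨?_, ?_, fun R hR b s s' h => ⟨R, hR, h⟩⟩
  · rw [QCCS.bisimilar_eq_chain]
    exact QCCS.Chain.equivalence
  · rw [QCCS.bisimilar_eq_chain]
    exact QCCS.Chain.isSymbolicBisimulation
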